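/- For $m>0$ let $\langle\xi\rangle_m=(m^2+|\xi|^2)^{1/2}$, $\xi\in\mathbb R^3$, and let $S_m(t)=e^{-it\langle D\rangle_m}$ be the propagator on $L^2(\mathbb R^3;\mathbb C)$ given by $\widehat{S_m(t)f}(\xi)=e^{-it\langle\xi\rangle_m}\hat f(\xi)$, where $\hat f(\xi)=\int e^{-ix\cdot\xi}f(x)\,dx$ for $f\in L^1\cap L^2$ (extended to $L^2$ by continuity). Write $\|u\|_{L^2_tL^\infty_x}=\big(\int_{\mathbb R}\|u(t)\|_{L^\infty(\mathbb R^3)}^2\,dt\big)^{1/2}$. A $U^2$-atom is a function $a:\mathbb R\to L^2(\mathbb R^3)$ of the form $a(t)=\sum_{k=1}^K\chi_{[t_{k-1},t_k)}(t)\,\phi_{k-1}$ with $-\infty<t_0<\dots<t_K\le\infty$, $\phi_k\in L^2(\mathbb R^3)$ and $\sum_{k=0}^{K-1}\|\phi_k\|_{L^2}^2=1$. The space $U^2$ consists of all $u=\sum_{j\ge1}c_ja_j$ with $U^2$-atoms $a_j$ and $(c_j)\in\ell^1(\mathbb N;\mathbb C)$, with norm $\|u\|_{U^2}=\inf\sum_j|c_j|$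 over all such representations. The space $U^2_m$ consists of all $u:\mathbb R\to L^2(\mathbb R^3)$ such that $t\mapsto S_m(-t)u(t)$ lies in $U^2$, with norm $\|u\|_{U^2_m}=\|S_m(-\cdot)u(\cdot)\|_{U^2}$. **Lemma 3.6 (localized Klein–Gordon Strichartz estimate).** Let $m>0$, $\varepsilon>0$ and $A\ge1$. There is a constant $C>0$, depending only on $m,\varepsilon,A$, such that the following holds for all real $\lambda,\mu>0$ with $A^{-1}\le\mu\le A\lambda$ and every closed cube $Q\subset\mathbb R^3$ (in arbitrary position) of side length $\mu$ with $A^{-1}\lambda\le\operatorname{dist}(0,Q)\le A\lambda$. 1. For every $f\in L^2(\mathbb R^3)$ such that $\hat f$ vanishes almost everywhere outside $Q$, $$\|S_m(t)f\|_{L^2_tL^\infty_x}\le C\,(\mu\lambda)^{1/2}\lambda^{\varepsilon}\,\|f\|_{L^2}.$$ 2. For every $u\in U^2_m$ such that, for every $t\in\mathbb R$, $\widehat{u(t)}$ vanishes almost everywhere outside $Q$, $$\|u\|_{L^2_tL^\infty_x}\le C\,(\mu\lambda)^{1/2}\lambda^{\varepsilon}\,\|u\|_{U^2_m}.$$ 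-/

import Mathlib

open MeasureTheory
open scoped FourierTransform ENNReal

namespace KleinGordon

/-- Physical space, and frequency space, `ℝ³`. -/
abbrev R3 : Type := EuclideanSpace ℝ (Fin 3)

/-- The Hilbert space `L²(ℝ³; ℂ)`. -/
abbrev L2 : Type := Lp ℂ 2 (volume : Measure R3)

noncomputable section

/-- The symbol `⟨ξ⟩_m = (m² + |ξ|²)^{1/2}`. -/
def bracket (m : ℝ) (ξ : R3) : ℝ := Real.sqrt (m ^ 2 + ‖ξ‖ ^ 2)

/-- The Fourier multiplier of `S_m(t)` in the variable `η` of Mathlib's Fourier transform, whose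
kernel is `exp (-2πi ⟨x, η⟩)`; the frequency is `ξ = 2πη`, so that `D = -i∇` has symbol `ξ`. -/
def propagatorSymbol (m t : ℝ) (η : R3) : ℂ :=
  Complex.exp (-(Complex.I * ((t * bracket m ((2 * Real.pi) • η) : ℝ) : ℂ)))

theorem norm_propagatorSymbol (m t : ℝ) (η : R3) : ‖propagatorSymbol m t η‖ = 1 := by
  rw [propagatorSymbol, Complex.norm_exp]
  simp

theorem continuous_propagatorSymbol (m t : ℝ) : Continuous (propagatorSymbol m t) := by
  unfold propagatorSymbol bracket
  fun_prop

theorem memLp_propagatorSymbol_mul (m t : ℝ) (g : L2) :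
    MemLp (fun η => propagatorSymbol m t η * g η) 2 (volume : Measure R3) := by
  refine (Lp.memLp g).of_le
    ((continuous_propagatorSymbol m t).aestronglyMeasurable.mul (Lp.aestronglyMeasurable g)) ?_
  filter_upwards with η
  rw [norm_mul, norm_propagatorSymbol, one_mul]

/-- The propagator `S_m(t) = exp (-it⟨D⟩_m)` on `L²(ℝ³)`: the Fourier transform of `S_m(t) f` at
the frequency `ξ` is `exp (-it⟨ξ⟩_m)` times that of `f`. -/
def S (m t : ℝ) (f : L2) : L2 :=
  𝓕⁻ ((memLp_propagatorSymbol_mul m t (𝓕 f)).toLp (fun η => propagatorSymbol m t η * (𝓕 f : L2) η))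

/-- The Fourier transform of `f`, as a function of the frequency `ξ = 2πη`, vanishes almost
everywhere outside `Q`. -/
def FreqSupportedIn (f : L2) (Q : Set R3) : Prop :=
  ∀ᵐ η : R3, (2 * Real.pi) • η ∉ Q → (𝓕 f : L2) η = 0

/-- `Q` is a closed cube of side length `s`, in arbitrary position: the image of `[0, s]³` under an
isometry of `ℝ³`. -/
def IsCube (s : ℝ) (Q : Set R3) : Prop :=
  ∃ g : R3 ≃ᵢ R3, Q = g '' {x : R3 | ∀ i, x i ∈ Set.Icc 0 s}

/-- The norm of `L²_t L^∞_x (ℝ^{1+3})`, with values in `[0, ∞]`. -/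
def normL2Linf (u : ℝ → L2) : ℝ≥0∞ :=
  (∫⁻ t : ℝ, eLpNorm (u t) ∞ (volume : Measure R3) ^ 2) ^ (1 / 2 : ℝ)

/-- `U^p`-atoms: step functions `∑_{k=1}^K χ_{[t_{k-1}, t_k)} φ_{k-1}` with
`-∞ < t_0 < ⋯ < t_K ≤ ∞` and `∑_k ‖φ_k‖^p = 1`. -/
def IsUAtom (p : ℝ) (a : ℝ → L2) : Prop :=
  ∃ (K : ℕ) (τ : Fin (K + 1) → EReal) (φ : Fin K → L2),
    StrictMono τ ∧ ⊥ < τ 0 ∧ ∑ k, ‖φ k‖ ^ p = 1 ∧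
    ∀ s : ℝ, a s =
      ∑ k : Fin K, Set.indicator (Set.Ico (τ k.castSucc) (τ k.succ)) (fun _ => φ k) (s : EReal)

/-- `u = ∑_j c_j a_j` with `U^p`-atoms `a_j` and `(c_j) ∈ ℓ¹`. -/
def IsURepr (p : ℝ) (u : ℝ → L2) (c : ℕ → ℂ) (a : ℕ → ℝ → L2) : Prop :=
  (∀ j, IsUAtom p (a j)) ∧ Summable (fun j => ‖c j‖) ∧
    ∀ s : ℝ, HasSum (fun j => c j • a j s) (u s)

/-- Membership in `U^p(ℝ; L²)`. -/
def MemU (p : ℝ) (u : ℝ → L2) : Prop := ∃ c a, IsURepr p u c a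

/-- The norm of `U^p(ℝ; L²)`: the infimum of `∑_j |c_j|` over all atomic representations
(`∞` if there is none). -/
def normU (p : ℝ) (u : ℝ → L2) : ℝ≥0∞ :=
  ⨅ (c : ℕ → ℂ) (a : ℕ → ℝ → L2) (_ : IsURepr p u c a), ∑' j, ‖c j‖ₑ

/-- Membership in `U^p_m(ℝ; L²)`. -/
def MemUm (p m : ℝ) (u : ℝ → L2) : Prop := MemU p (fun t => S m (-t) (u t))

/-- The norm of `U^p_m(ℝ; L²)`. -/
def normUm (p m : ℝ) (u : ℝ → L2) : ℝ≥0∞ := normU p (fun t => S m (-t) (u t))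

end

end KleinGordon

/-!
The homogeneous estimate is proved by duality (`TT*`). For `f` with frequencies in `Q`, the value
`(S_m(t) f)(x)` is the inner product of `𝓕 f` with a vector `waveVec … m t x` of `L²`, and it
suffices to control the Gram matrix of these vectors, that is, to find `k` with
`‖K(t - s, x - y)‖ ≤ k (t - s)` for all `x, y` and `∫ k ≲ μ λ λ^{2ε}`, where `K` is the kernel of
`exp(-it⟨D⟩_m)` with a smooth frequency cutoff (`lintegral_iSup_inner_sq_le`; the supremum over `x`
is reduced to a measurable choice among finitely many points).

The cutoff is a radial bump `ψ(|ξ|)`, living on the shell `|ξ| = |ξ₀| + O(μ)` that contains `Q`,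
times a Gaussian of width `μ` about a point `ξ₀` of `Q`; on `Q` it is bounded below. The Gaussian
factor yields the trivial bound `μ³` (`norm_localKernel_le`), and it costs nothing in the
dispersive bounds, since multiplication by it is convolution of the kernel in `x` with an `L¹`
function of norm one (`norm_localKernel_le_of_shellKernel`). So only the kernel of the full shell
has to be estimated, and this is a one-dimensional integral (`integral_radial_mul_cexp`), with
phase `c r - τ ⟨r⟩_m`, averaged over `c ∈ [-|x|, |x|]`. There are three bounds
(`exists_norm_shellKernel_le`):

* for `|x|` at most a small multiple of `|τ|` the phase has no stationary point, and two
  integrations by parts give `λ² / (μ τ²)`;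
* for larger `|x|` the factor `1 / |x|` coming from the curvature of the sphere gives `λ μ / |τ|`;
* there the radial phase also has second derivative `~ m² |τ| / λ³`, and van der Corput's lemma
  gives the bound `λ^{5/2} |τ|^{-3/2}`, which is integrable at infinity.

The last two are interpolated, with a small weight, at most `ε`, on the last one: the bound
becomes integrable, and the loss is at most a constant times `λ^{2ε}` (`exists_localKernel_le`).
With the trivial bound for `|τ| ≤ λ / μ²`, the integral in time is `≲ μ λ λ^{2ε}`.

The estimate for `U²` follows by applying the homogeneous one to every step of an atom: at each
time the square of the supremum is at most the sum of its values for the steps of the atom, and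
`∑ ‖φ_k‖² = 1`. The series over the atoms is summed with the Cauchy–Schwarz inequality
(`lintegral_iSup_inner_sq_le_of_isURepr`).
-/

namespace KleinGordon

/-! ### One-dimensional oscillatory integrals -/

open Complex in
/-- Integration by parts against the phase `φ`, whose derivative is `p`. -/
theorem integral_cexp_mul_deriv_mul {φ p b b' : ℝ → ℝ} {α β : ℝ} (hαβ : α ≤ β)
    (hφ : ∀ r ∈ Set.Icc α β, HasDerivAt φ (p r) r)
    (hb : ∀ r ∈ Set.Icc α β, HasDerivAt b (b' r) r)
    (hp : ContinuousOn p (Set.Icc α β)) (hb' : ContinuousOn b' (Set.Icc α β))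
    (hα : b α = 0) (hβ : b β = 0) :
    ∫ r in α..β, cexp (I * φ r) * (p r * b r : ℝ) =
      I * ∫ r in α..β, cexp (I * φ r) * (b' r : ℝ) := by
  have hu : Set.uIcc α β = Set.Icc α β := Set.uIcc_of_le hαβ
  have hφc : ContinuousOn φ (Set.Icc α β) :=
    fun r hr => (hφ r hr).continuousAt.continuousWithinAt
  have h := intervalIntegral.integral_mul_deriv_eq_deriv_mul (a := α) (b := β)
    (u := fun r => (b r : ℂ)) (v := fun r => cexp (I * φ r)) (u' := fun r => (b' r : ℂ))
    (v' := fun r => cexp (I * φ r) * (I * p r))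
    (fun r hr => (hb r (hu ▸ hr)).ofReal_comp)
    (fun r hr => ((hφ r (hu ▸ hr)).ofReal_comp.const_mul I).cexp)
    (by
      apply ContinuousOn.intervalIntegrable; rw [hu]
      exact continuous_ofReal.comp_continuousOn hb')
    (by
      apply ContinuousOn.intervalIntegrable; rw [hu]
      fun_prop)
  simp only [hα, hβ, ofReal_zero, zero_mul, sub_zero, zero_sub] at h
  have e1 : ∫ r in α..β, cexp (I * φ r) * (p r * b r : ℝ) =
      -I * ∫ r in α..β, (b r : ℂ) * (cexp (I * φ r) * (I * p r)) := by
    rw [← intervalIntegral.integral_const_mul]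
    refine intervalIntegral.integral_congr fun r _ => ?_
    push_cast
    linear_combination (cexp (I * φ r) * p r * b r) * I_sq
  rw [e1, h, ← neg_mul_neg, neg_neg, neg_neg]
  congr 1
  exact intervalIntegral.integral_congr fun r _ => mul_comm _ _

theorem norm_cexp_I_mul_ofReal (x : ℝ) : ‖Complex.exp (Complex.I * x)‖ = 1 := by
  rw [mul_comm]; exact Complex.norm_exp_ofReal_mul_I x

/-- Two integrations by parts, for a phase without stationary points: `q` is the reciprocal of
the derivative `p` of the phase, and `q` and the amplitude `a` vary on the scale `s`. -/
theorem norm_integral_cexp_le_of_nonstationary {φ p q q1 q2 a a1 a2 : ℝ → ℝ} {α β s Ma Mq : ℝ}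
    (hαβ : α ≤ β) (hs : 0 < s)
    (hφ : ∀ r ∈ Set.Icc α β, HasDerivAt φ (p r) r)
    (hp : ContinuousOn p (Set.Icc α β))
    (hpq : ∀ r ∈ Set.Icc α β, p r * q r = 1)
    (hq : ∀ r ∈ Set.Icc α β, HasDerivAt q (q1 r) r)
    (hq1 : ∀ r ∈ Set.Icc α β, HasDerivAt q1 (q2 r) r)
    (hq2 : ContinuousOn q2 (Set.Icc α β))
    (ha : ∀ r ∈ Set.Icc α β, HasDerivAt a (a1 r) r)
    (ha1 : ∀ r ∈ Set.Icc α β, HasDerivAt a1 (a2 r) r)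
    (ha2 : ContinuousOn a2 (Set.Icc α β))
    (haα : a α = 0) (haβ : a β = 0) (ha1α : a1 α = 0) (ha1β : a1 β = 0)
    (bq : ∀ r ∈ Set.Icc α β, |q r| ≤ Mq) (bq1 : ∀ r ∈ Set.Icc α β, |q1 r| ≤ Mq / s)
    (bq2 : ∀ r ∈ Set.Icc α β, |q2 r| ≤ Mq / s ^ 2)
    (ba : ∀ r ∈ Set.Icc α β, |a r| ≤ Ma) (ba1 : ∀ r ∈ Set.Icc α β, |a1 r| ≤ Ma / s)
    (ba2 : ∀ r ∈ Set.Icc α β, |a2 r| ≤ Ma / s ^ 2) :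
    ‖∫ r in α..β, Complex.exp (Complex.I * φ r) * (a r : ℂ)‖ ≤
      6 * Ma * Mq ^ 2 / s ^ 2 * (β - α) := by
  have hu : Set.uIcc α β = Set.Icc α β := Set.uIcc_of_le hαβ
  have cq : ContinuousOn q (Set.Icc α β) := fun r hr => (hq r hr).continuousAt.continuousWithinAt
  have cq1 : ContinuousOn q1 (Set.Icc α β) :=
    fun r hr => (hq1 r hr).continuousAt.continuousWithinAt
  have ca : ContinuousOn a (Set.Icc α β) := fun r hr => (ha r hr).continuousAt.continuousWithinAt
  have ca1 : ContinuousOn a1 (Set.Icc α β) :=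
    fun r hr => (ha1 r hr).continuousAt.continuousWithinAt
  set b : ℝ → ℝ := fun r => q1 r * a r + q r * a1 r with hb
  set b1 : ℝ → ℝ := fun r => (q2 r * a r + q1 r * a1 r) + (q1 r * a1 r + q r * a2 r) with hb1
  have e1 : ∫ r in α..β, Complex.exp (Complex.I * φ r) * (a r : ℂ) =
      Complex.I * ∫ r in α..β, Complex.exp (Complex.I * φ r) * (b r : ℂ) := by
    rw [← integral_cexp_mul_deriv_mul (b := fun r => q r * a r) hαβ hφ
      (fun r hr => (hq r hr).mul (ha r hr)) hp (by fun_prop) (by simp [haα]) (by simp [haβ])]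
    refine intervalIntegral.integral_congr fun r hr => ?_
    rw [← mul_assoc, hpq r (hu ▸ hr), one_mul]
  have e2 : ∫ r in α..β, Complex.exp (Complex.I * φ r) * (b r : ℂ) =
      Complex.I * ∫ r in α..β, Complex.exp (Complex.I * φ r) *
        ((q1 r * b r + q r * b1 r : ℝ) : ℂ) := by
    rw [← integral_cexp_mul_deriv_mul (b := fun r => q r * b r) hαβ hφ
      (fun r hr => (hq r hr).mul
        (((hq1 r hr).mul (ha r hr)).add ((hq r hr).mul (ha1 r hr)))) hp (by fun_prop)
        (by simp [hb, haα, ha1α]) (by simp [hb, haβ, ha1β])]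
    refine intervalIntegral.integral_congr fun r hr => ?_
    rw [← mul_assoc (p r), hpq r (hu ▸ hr), one_mul]
  rw [e1, e2, norm_mul, norm_mul, Complex.norm_I, one_mul, one_mul]
  have h := intervalIntegral.norm_integral_le_of_norm_le_const (a := α) (b := β)
    (C := 6 * Ma * Mq ^ 2 / s ^ 2)
    (f := fun r => Complex.exp (Complex.I * φ r) * ((q1 r * b r + q r * b1 r : ℝ) : ℂ)) ?_
  · rwa [abs_of_nonneg (sub_nonneg.2 hαβ)] at h
  intro r hr
  have hr' : r ∈ Set.Icc α β := hu ▸ Set.uIoc_subset_uIcc hr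
  rw [norm_mul, norm_cexp_I_mul_ofReal, one_mul, Complex.norm_real, Real.norm_eq_abs]
  have hMq : 0 ≤ Mq := (abs_nonneg _).trans (bq r hr')
  have hMa : 0 ≤ Ma := (abs_nonneg _).trans (ba r hr')
  have m1 : |q1 r * a r| ≤ Mq / s * Ma := by
    rw [abs_mul]; exact mul_le_mul (bq1 r hr') (ba r hr') (abs_nonneg _) (by positivity)
  have m2 : |q r * a1 r| ≤ Mq * (Ma / s) := by
    rw [abs_mul]; exact mul_le_mul (bq r hr') (ba1 r hr') (abs_nonneg _) (by positivity)
  have m3 : |q2 r * a r| ≤ Mq / s ^ 2 * Ma := by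
    rw [abs_mul]; exact mul_le_mul (bq2 r hr') (ba r hr') (abs_nonneg _) (by positivity)
  have m4 : |q1 r * a1 r| ≤ Mq / s * (Ma / s) := by
    rw [abs_mul]; exact mul_le_mul (bq1 r hr') (ba1 r hr') (abs_nonneg _) (by positivity)
  have m5 : |q r * a2 r| ≤ Mq * (Ma / s ^ 2) := by
    rw [abs_mul]; exact mul_le_mul (bq r hr') (ba2 r hr') (abs_nonneg _) (by positivity)
  have n1 : |b r| ≤ 2 * (Ma * Mq / s) := by
    calc |b r| ≤ |q1 r * a r| + |q r * a1 r| := abs_add_le _ _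
      _ ≤ Mq / s * Ma + Mq * (Ma / s) := add_le_add m1 m2
      _ = _ := by ring
  have n2 : |b1 r| ≤ 4 * (Ma * Mq / s ^ 2) := by
    calc |b1 r| ≤ (|q2 r * a r| + |q1 r * a1 r|) + (|q1 r * a1 r| + |q r * a2 r|) :=
          (abs_add_le _ _).trans (add_le_add (abs_add_le _ _) (abs_add_le _ _))
      _ ≤ (Mq / s ^ 2 * Ma + Mq / s * (Ma / s)) + (Mq / s * (Ma / s) + Mq * (Ma / s ^ 2)) :=
          add_le_add (add_le_add m3 m4) (add_le_add m4 m5)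
      _ = _ := by field_simp; ring
  calc |q1 r * b r + q r * b1 r| ≤ |q1 r| * |b r| + |q r| * |b1 r| := by
        rw [← abs_mul, ← abs_mul]; exact abs_add_le _ _
    _ ≤ Mq / s * (2 * (Ma * Mq / s)) + Mq * (4 * (Ma * Mq / s ^ 2)) := by
        gcongr
        · exact bq1 r hr'
        · exact bq r hr'
    _ = _ := by field_simp; ring

/-- Van der Corput's second derivative test. The weight `ν² / (p² + ν²)`, with `ν² = κ`, isolates
the stationary point; the rest is integrated by parts once, and both parts are controlled by the
total variation of `arctan (p / ν)`, which is at most `π`. -/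
theorem norm_integral_cexp_le_of_le_deriv {φ p p1 a a1 : ℝ → ℝ} {α β κ Ma Ma1 : ℝ}
    (hαβ : α ≤ β) (hκ : 0 < κ)
    (hφ : ∀ r ∈ Set.Icc α β, HasDerivAt φ (p r) r)
    (hp : ∀ r ∈ Set.Icc α β, HasDerivAt p (p1 r) r)
    (hp1 : ContinuousOn p1 (Set.Icc α β)) (hκp : ∀ r ∈ Set.Icc α β, κ ≤ p1 r)
    (ha : ∀ r ∈ Set.Icc α β, HasDerivAt a (a1 r) r)
    (ha1 : ContinuousOn a1 (Set.Icc α β))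
    (haα : a α = 0) (haβ : a β = 0)
    (ba : ∀ r ∈ Set.Icc α β, |a r| ≤ Ma) (ba1 : ∀ r ∈ Set.Icc α β, |a1 r| ≤ Ma1) :
    ‖∫ r in α..β, Complex.exp (Complex.I * φ r) * (a r : ℂ)‖ ≤
      (2 * Real.pi * Ma + Ma1 * (β - α)) / Real.sqrt κ := by
  have hu : Set.uIcc α β = Set.Icc α β := Set.uIcc_of_le hαβ
  have cφ : ContinuousOn φ (Set.Icc α β) := fun r hr => (hφ r hr).continuousAt.continuousWithinAt
  have cp : ContinuousOn p (Set.Icc α β) := fun r hr => (hp r hr).continuousAt.continuousWithinAt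
  have ca : ContinuousOn a (Set.Icc α β) := fun r hr => (ha r hr).continuousAt.continuousWithinAt
  have hMa : 0 ≤ Ma := (abs_nonneg _).trans (ba α ⟨le_rfl, hαβ⟩)
  have hMa1 : 0 ≤ Ma1 := (abs_nonneg _).trans (ba1 α ⟨le_rfl, hαβ⟩)
  set ν : ℝ := Real.sqrt κ with hν
  have hν0 : 0 < ν := Real.sqrt_pos.2 hκ
  have hνκ : ν ^ 2 = κ := Real.sq_sqrt hκ.le
  have hD : ∀ r, 0 < p r ^ 2 + ν ^ 2 := fun r => by positivity
  have hD' : ∀ r, p r ^ 2 + ν ^ 2 ≠ 0 := fun r => (hD r).ne'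
  set Q : ℝ → ℝ := fun r => p r / (p r ^ 2 + ν ^ 2) with hQ
  set Q1 : ℝ → ℝ := fun r => (p1 r * (p r ^ 2 + ν ^ 2) - p r * (2 * p r * p1 r)) /
    (p r ^ 2 + ν ^ 2) ^ 2 with hQ1
  set W : ℝ → ℝ := fun r => p1 r / (p r ^ 2 + ν ^ 2) with hW
  have dQ : ∀ r ∈ Set.Icc α β, HasDerivAt Q (Q1 r) r := fun r hr => by
    have h2 : HasDerivAt (fun r => p r ^ 2 + ν ^ 2) (2 * p r * p1 r) r := by
      simpa using ((hp r hr).pow 2).add_const (ν ^ 2)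
    exact (hp r hr).div h2 (hD' r)
  have cD : ContinuousOn (fun r => p r ^ 2 + ν ^ 2) (Set.Icc α β) := by fun_prop
  have cW : ContinuousOn W (Set.Icc α β) := hp1.div cD fun r _ => hD' r
  have cQ : ContinuousOn Q (Set.Icc α β) := cp.div cD fun r _ => hD' r
  have cQ1 : ContinuousOn Q1 (Set.Icc α β) :=
    ContinuousOn.div (by fun_prop) (cD.pow 2) fun r _ => pow_ne_zero 2 (hD' r)
  -- the derivative of `arctan (p / ν) / ν` is `W`
  have iW : ∫ r in α..β, W r ≤ Real.pi / ν := by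
    rw [intervalIntegral.integral_eq_sub_of_hasDerivAt
      (f := fun r => Real.arctan (p r / ν) / ν) (fun r hr => ?_)
      (ContinuousOn.intervalIntegrable (by rwa [hu]))]
    · rw [← sub_div]
      gcongr
      linarith [Real.arctan_lt_pi_div_two (p β / ν), Real.neg_pi_div_two_lt_arctan (p α / ν)]
    · have h := (((hp r (hu ▸ hr)).div_const ν).arctan).div_const ν
      convert! h using 1
      have := hD' r
      simp only [hW]
      field_simp
      rw [add_comm]
  have bQ : ∀ r, |Q r| ≤ 1 / ν := fun r => by
    simp only [hQ]
    rw [abs_div, abs_of_pos (hD r), div_le_div_iff₀ (hD r) hν0]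
    nlinarith [sq_nonneg (|p r| - ν), sq_abs (p r), abs_nonneg (p r)]
  have hWpos : ∀ r ∈ Set.Icc α β, 0 ≤ W r := fun r hr =>
    div_nonneg (hκ.le.trans (hκp r hr)) (hD r).le
  have bQ1 : ∀ r ∈ Set.Icc α β, |Q1 r| ≤ W r := fun r hr => by
    have h1 : 0 ≤ p1 r := hκ.le.trans (hκp r hr)
    have e : Q1 r = W r * ((ν ^ 2 - p r ^ 2) / (p r ^ 2 + ν ^ 2)) := by
      simp only [hQ1, hW]; have := hD' r; field_simp; ring
    rw [e, abs_mul, abs_of_nonneg (hWpos r hr)]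
    refine mul_le_of_le_one_right (hWpos r hr) ?_
    rw [abs_div, abs_of_pos (hD r), div_le_one (hD r), abs_le]
    constructor <;> nlinarith [sq_nonneg (p r), sq_nonneg ν]
  have split : ∫ r in α..β, Complex.exp (Complex.I * φ r) * (a r : ℂ) =
      Complex.I * (∫ r in α..β, Complex.exp (Complex.I * φ r) *
        ((Q1 r * a r + Q r * a1 r : ℝ) : ℂ)) +
      ∫ r in α..β, Complex.exp (Complex.I * φ r) * ((ν ^ 2 / (p r ^ 2 + ν ^ 2) * a r : ℝ) : ℂ) := by
    rw [← integral_cexp_mul_deriv_mul (b := fun r => Q r * a r) hαβ hφ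
      (fun r hr => (dQ r hr).mul (ha r hr)) cp (by fun_prop) (by simp [haα]) (by simp [haβ]),
      ← intervalIntegral.integral_add]
    · refine intervalIntegral.integral_congr fun r hr => ?_
      rw [← mul_add, ← Complex.ofReal_add]
      congr 2
      simp only [hQ]
      have := hD' r
      field_simp
    · apply ContinuousOn.intervalIntegrable; rw [hu]; fun_prop
    · apply ContinuousOn.intervalIntegrable; rw [hu]
      have : ContinuousOn (fun r => ν ^ 2 / (p r ^ 2 + ν ^ 2)) (Set.Icc α β) :=
        continuousOn_const.div cD fun r _ => hD' r
      fun_prop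
  have iI : ∀ {f : ℝ → ℝ}, ContinuousOn f (Set.Icc α β) → IntervalIntegrable f volume α β :=
    fun hf => ContinuousOn.intervalIntegrable (by rwa [hu])
  have b1 : ‖∫ r in α..β, Complex.exp (Complex.I * φ r) *
        ((Q1 r * a r + Q r * a1 r : ℝ) : ℂ)‖ ≤ ∫ r in α..β, (Ma * W r + Ma1 / ν) := by
    refine intervalIntegral.norm_integral_le_of_norm_le hαβ (ae_of_all _ fun r hr => ?_)
      (iI (by fun_prop))
    have hr' := Set.Ioc_subset_Icc_self hr
    rw [norm_mul, norm_cexp_I_mul_ofReal, one_mul, Complex.norm_real, Real.norm_eq_abs]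
    calc _ ≤ |Q1 r| * |a r| + |Q r| * |a1 r| := by
          rw [← abs_mul, ← abs_mul]; exact abs_add_le _ _
      _ ≤ W r * Ma + 1 / ν * Ma1 := by
          gcongr
          · exact hWpos r hr'
          · exact bQ1 r hr'
          · exact ba r hr'
          · exact bQ r
          · exact ba1 r hr'
      _ = _ := by ring
  have b2 : ‖∫ r in α..β, Complex.exp (Complex.I * φ r) *
        ((ν ^ 2 / (p r ^ 2 + ν ^ 2) * a r : ℝ) : ℂ)‖ ≤ ∫ r in α..β, Ma * W r := by
    refine intervalIntegral.norm_integral_le_of_norm_le hαβ (ae_of_all _ fun r hr => ?_)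
      (iI (by fun_prop))
    have hr' := Set.Ioc_subset_Icc_self hr
    rw [norm_mul, norm_cexp_I_mul_ofReal, one_mul, Complex.norm_real, Real.norm_eq_abs, abs_mul,
      abs_of_nonneg (div_nonneg (sq_nonneg _) (hD r).le), mul_comm Ma]
    have h1 : ν ^ 2 / (p r ^ 2 + ν ^ 2) ≤ W r :=
      div_le_div_of_nonneg_right (hνκ ▸ hκp r hr') (hD r).le
    exact mul_le_mul h1 (ba r hr') (abs_nonneg _) (hWpos r hr')
  rw [intervalIntegral.integral_add (iI (by fun_prop)) (iI (by fun_prop)),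
    intervalIntegral.integral_const, intervalIntegral.integral_const_mul, smul_eq_mul] at b1
  rw [intervalIntegral.integral_const_mul] at b2
  rw [split]
  refine (norm_add_le _ _).trans ?_
  rw [norm_mul, Complex.norm_I, one_mul]
  have := mul_le_mul_of_nonneg_left iW hMa
  calc _ ≤ (Ma * (Real.pi / ν) + (β - α) * (Ma1 / ν)) + Ma * (Real.pi / ν) := by linarith
    _ = _ := by ring

theorem norm_integral_cexp_neg (φ a : ℝ → ℝ) (α β : ℝ) :
    ‖∫ r in α..β, Complex.exp (Complex.I * (-φ r : ℝ)) * (a r : ℂ)‖ =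
      ‖∫ r in α..β, Complex.exp (Complex.I * φ r) * (a r : ℂ)‖ := by
  rw [← RCLike.norm_conj, ← intervalIntegral.intervalIntegral_conj]
  congr 1
  refine intervalIntegral.integral_congr fun r _ => ?_
  simp [← Complex.exp_conj]

/-! ### Fourier integrals of radial functions on `ℝ³` -/

/-- Splitting `ℝ³ = ℝ × ℝ²`. -/
def splitEquiv : R3 ≃ᵐ ℝ × EuclideanSpace ℝ (Fin 2) :=
  ((MeasurableEquiv.toLp 2 (Fin 3 → ℝ)).symm.trans
    (MeasurableEquiv.piFinSuccAbove (fun _ : Fin 3 => ℝ) 0)).trans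
    ((MeasurableEquiv.refl ℝ).prodCongr (MeasurableEquiv.toLp 2 (Fin 2 → ℝ)))

theorem measurePreserving_splitEquiv : MeasurePreserving splitEquiv := by
  refine ((MeasurePreserving.id volume).prod (PiLp.volume_preserving_toLp (Fin 2))).comp
    ((volume_preserving_piFinSuccAbove (fun _ : Fin 3 => ℝ) 0).comp
      (PiLp.volume_preserving_ofLp (Fin 3)))

theorem splitEquiv_fst (ξ : R3) : (splitEquiv ξ).1 = ξ 0 := rfl

theorem norm_sq_splitEquiv (ξ : R3) : ‖ξ‖ ^ 2 = (splitEquiv ξ).1 ^ 2 + ‖(splitEquiv ξ).2‖ ^ 2 := by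
  rw [EuclideanSpace.norm_sq_eq, EuclideanSpace.norm_sq_eq, Fin.sum_univ_succ]
  simp [splitEquiv_fst]
  rfl

theorem integral_comp_fst_norm (g : ℝ → ℝ → ℂ) :
    ∫ ξ : R3, g (ξ 0) ‖ξ‖ =
      ∫ p : ℝ × EuclideanSpace ℝ (Fin 2), g p.1 (Real.sqrt (p.1 ^ 2 + ‖p.2‖ ^ 2)) := by
  rw [← measurePreserving_splitEquiv.integral_comp' (g := fun p =>
    g p.1 (Real.sqrt (p.1 ^ 2 + ‖p.2‖ ^ 2)))]
  refine integral_congr_ae (ae_of_all _ fun ξ => ?_)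
  simp only
  rw [← norm_sq_splitEquiv, Real.sqrt_sq (norm_nonneg _), splitEquiv_fst]

/-- The integral over a plane at height `z` of a radial function. -/
theorem integral_sqrt_add_norm_sq {F : ℝ → ℂ} (hF : Continuous F) (hFc : HasCompactSupport F)
    (z : ℝ) :
    ∫ η : EuclideanSpace ℝ (Fin 2), F (Real.sqrt (z ^ 2 + ‖η‖ ^ 2)) =
      2 * Real.pi * ∫ r in Set.Ioi |z|, (r : ℂ) * F r := by
  rw [integral_fun_norm_addHaar volume (fun y => F (Real.sqrt (z ^ 2 + y ^ 2)))]
  have hball : (volume : Measure (EuclideanSpace ℝ (Fin 2))).real (Metric.ball 0 1) = Real.pi := by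
    rw [Measure.real, InnerProductSpace.volume_ball_of_dim_even (k := 1) (by simp)]
    simp [Real.pi_pos.le]
  rw [hball]
  simp only [finrank_euclideanSpace, Fintype.card_fin, Nat.add_one_sub_one, pow_one, nsmul_eq_mul,
    Nat.cast_ofNat, Complex.real_smul]
  rw [← mul_assoc]
  congr 1
  have hg : Continuous fun r : ℝ => (r : ℂ) * F r := by fun_prop
  have hgc : HasCompactSupport fun r : ℝ => (r : ℂ) * F r := hFc.mul_left
  have hgi : Integrable fun r : ℝ => (r : ℂ) * F r := hg.integrable_of_hasCompactSupport hgc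
  have key := integral_deriv_smul_comp_Ioi (f := fun y => Real.sqrt (z ^ 2 + y ^ 2))
    (f' := fun y => y / Real.sqrt (z ^ 2 + y ^ 2)) (g := fun r : ℝ => (r : ℂ) * F r) (a := 0)
    (by fun_prop) ?_ ?_ hg.continuousOn hgi.integrableOn ?_
  · simp only [Function.comp_def] at key
    rw [show Real.sqrt (z ^ 2 + 0 ^ 2) = |z| by simp [Real.sqrt_sq_eq_abs]] at key
    rw [← key]
    refine setIntegral_congr_fun measurableSet_Ioi fun y hy => ?_
    have hy : 0 < y := hy
    have : Real.sqrt (z ^ 2 + y ^ 2) ≠ 0 := (Real.sqrt_pos.2 (by positivity)).ne'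
    simp only [Complex.real_smul]
    rw [← mul_assoc, ← Complex.ofReal_mul, div_mul_cancel₀ _ this]
  · refine Filter.tendsto_atTop_mono (fun y => Real.le_sqrt_of_sq_le ?_) Filter.tendsto_id
    simp only [id]; nlinarith [sq_nonneg z]
  · intro y hy
    have hy : 0 < y := hy
    have h : HasDerivAt (fun y => z ^ 2 + y ^ 2) (2 * y) y := by
      simpa using (hasDerivAt_pow 2 y).const_add (z ^ 2)
    refine ((h.sqrt (by positivity)).congr_deriv ?_).hasDerivWithinAt
    have : Real.sqrt (z ^ 2 + y ^ 2) ≠ 0 := (Real.sqrt_pos.2 (by positivity)).ne'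
    field_simp
  · have hc : HasCompactSupport fun y : ℝ => (y : ℂ) * F (Real.sqrt (z ^ 2 + y ^ 2)) := by
      obtain ⟨R, hR⟩ := hFc.isCompact.isBounded.subset_closedBall 0
      refine HasCompactSupport.of_support_subset_isCompact (isCompact_closedBall (0 : ℝ) R)
        fun y hy => ?_
      have h1 : F (Real.sqrt (z ^ 2 + y ^ 2)) ≠ 0 := right_ne_zero_of_mul hy
      have h2 := hR (subset_tsupport _ h1)
      rw [mem_closedBall_zero_iff, Real.norm_eq_abs] at h2 ⊢
      refine le_trans ?_ h2
      rw [abs_of_nonneg (Real.sqrt_nonneg _)]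
      exact Real.abs_le_sqrt (by nlinarith [sq_nonneg z])
    have hi : Integrable fun y : ℝ => (y : ℂ) * F (Real.sqrt (z ^ 2 + y ^ 2)) :=
      Continuous.integrable_of_hasCompactSupport (by fun_prop) hc
    refine IntegrableOn.congr_fun hi.integrableOn (fun y hy => ?_) measurableSet_Ici
    simp only [Function.comp_def, Complex.real_smul]
    rcases eq_or_lt_of_le (show (0 : ℝ) ≤ y from hy) with h | hy
    · subst h; simp
    · have : Real.sqrt (z ^ 2 + y ^ 2) ≠ 0 := (Real.sqrt_pos.2 (by positivity)).ne'
      rw [← mul_assoc, ← Complex.ofReal_mul, div_mul_cancel₀ _ this]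

/-- A rotation of `ℝ³` that takes `x` to the first coordinate axis. -/
theorem exists_isometry_inner_eq (x : R3) :
    ∃ e : R3 ≃ₗᵢ[ℝ] R3, ∀ ξ, inner ℝ x ξ = ‖x‖ * (e ξ) 0 := by
  by_cases hx : x = 0
  · exact ⟨LinearIsometryEquiv.refl ℝ R3, fun ξ => by simp [hx]⟩
  have hv : Orthonormal ℝ (({0} : Set (Fin 3)).domRestrict fun _ : Fin 3 => (‖x‖⁻¹ • x : R3)) := by
    have : Subsingleton ({0} : Set (Fin 3)) := Set.subsingleton_singleton.coe_sort
    refine ⟨fun i => ?_, fun i j hij => (hij (Subsingleton.elim i j)).elim⟩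
    simp [norm_smul, hx]
  obtain ⟨b, hb⟩ := hv.exists_orthonormalBasis_extension_of_card_eq (by simp)
  refine ⟨b.repr, fun ξ => ?_⟩
  rw [b.repr_apply_apply, hb 0 rfl, real_inner_smul_left, ← mul_assoc,
    mul_inv_cancel₀ (norm_ne_zero_iff.2 hx), one_mul]

/-- The Fourier integral of a radial function on `ℝ³`, as an integral over the radius `r` and the
height `z` in the direction of `x`: by Archimedes, the height is uniformly distributed on the
sphere of radius `r`. -/
theorem integral_radial_mul_cexp {F : ℝ → ℂ} (hF : Continuous F) {α β : ℝ} (hα : 0 ≤ α)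
    (hαβ : α ≤ β) (hFs : ∀ r, r ∉ Set.Icc α β → F r = 0) (x : R3) :
    ∫ ξ : R3, F ‖ξ‖ * Complex.exp (Complex.I * (inner ℝ x ξ : ℝ)) =
      2 * Real.pi * ∫ r in α..β, (r * F r) *
        ∫ z in -r..r, Complex.exp (Complex.I * (‖x‖ * z : ℝ)) := by
  have hFc : HasCompactSupport F := HasCompactSupport.intro isCompact_Icc hFs
  obtain ⟨e, he⟩ := exists_isometry_inner_eq x
  have h1 : ∫ ξ : R3, F ‖ξ‖ * Complex.exp (Complex.I * (inner ℝ x ξ : ℝ)) =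
      ∫ ξ : R3, F ‖ξ‖ * Complex.exp (Complex.I * (‖x‖ * ξ 0 : ℝ)) := by
    rw [← e.measurePreserving.integral_comp e.toHomeomorph.measurableEmbedding
      (fun ξ : R3 => F ‖ξ‖ * Complex.exp (Complex.I * (‖x‖ * ξ 0 : ℝ)))]
    simp only [he, LinearIsometryEquiv.norm_map]
  have hcc : HasCompactSupport fun p : ℝ × EuclideanSpace ℝ (Fin 2) =>
      F (Real.sqrt (p.1 ^ 2 + ‖p.2‖ ^ 2)) * Complex.exp (Complex.I * (‖x‖ * p.1 : ℝ)) := by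
    refine HasCompactSupport.of_support_subset_isCompact
      ((isCompact_closedBall (0 : ℝ) β).prod (isCompact_closedBall 0 β)) fun p hp => ?_
    have h2 : Real.sqrt (p.1 ^ 2 + ‖p.2‖ ^ 2) ≤ β := by
      by_contra h
      exact left_ne_zero_of_mul hp (hFs _ fun h' => h h'.2)
    rw [Set.mem_prod, mem_closedBall_zero_iff, mem_closedBall_zero_iff, Real.norm_eq_abs]
    exact ⟨(Real.abs_le_sqrt (by nlinarith [sq_nonneg ‖p.2‖])).trans h2,
      (Real.le_sqrt_of_sq_le (by nlinarith [sq_nonneg p.1])).trans h2⟩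
  have hint : Integrable fun p : ℝ × EuclideanSpace ℝ (Fin 2) =>
      F (Real.sqrt (p.1 ^ 2 + ‖p.2‖ ^ 2)) * Complex.exp (Complex.I * (‖x‖ * p.1 : ℝ)) :=
    (show Continuous _ by fun_prop).integrable_of_hasCompactSupport hcc
  rw [h1, integral_comp_fst_norm (fun z r => F r * Complex.exp (Complex.I * (‖x‖ * z : ℝ)))]
  rw [show (volume : Measure (ℝ × EuclideanSpace ℝ (Fin 2))) = volume.prod volume from rfl,
    integral_prod _ hint]
  simp_rw [integral_mul_const, integral_sqrt_add_norm_sq hF hFc, mul_assoc]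
  rw [integral_const_mul, integral_const_mul]
  congr 2
  set G : ℝ × ℝ → ℂ := fun p => Set.indicator {p : ℝ × ℝ | |p.1| < p.2}
    (fun p => (p.2 * F p.2) * Complex.exp (Complex.I * (‖x‖ * p.1 : ℝ))) p with hG
  have hset : MeasurableSet {p : ℝ × ℝ | |p.1| < p.2} :=
    (isOpen_lt (by fun_prop) (by fun_prop)).measurableSet
  have hGi : Integrable G (volume.prod volume) := by
    have h2 : IntegrableOn (fun p : ℝ × ℝ => (p.2 * F p.2) *
        Complex.exp (Complex.I * (‖x‖ * p.1 : ℝ)))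
        (Set.Icc (-β) β ×ˢ Set.Icc α β) (volume.prod volume) :=
      ContinuousOn.integrableOn_compact (isCompact_Icc.prod isCompact_Icc) (by fun_prop)
    rw [← integrable_indicator_iff (measurableSet_Icc.prod measurableSet_Icc)] at h2
    refine (h2.indicator hset).congr (ae_of_all _ fun p => ?_)
    simp only [hG]
    by_cases hp : |p.1| < p.2
    · rw [Set.indicator_of_mem (show p ∈ {p : ℝ × ℝ | |p.1| < p.2} from hp),
        Set.indicator_of_mem (show p ∈ {p : ℝ × ℝ | |p.1| < p.2} from hp)]
      by_cases h3 : p.2 ∈ Set.Icc α β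
      · rw [Set.indicator_of_mem]
        exact ⟨abs_le.1 (hp.le.trans h3.2), h3⟩
      · rw [Set.indicator_of_notMem (fun h => h3 h.2), hFs _ h3]
        simp
    · rw [Set.indicator_of_notMem (show p ∉ {p : ℝ × ℝ | |p.1| < p.2} from hp),
        Set.indicator_of_notMem (show p ∉ {p : ℝ × ℝ | |p.1| < p.2} from hp)]
  have e1 : ∀ z : ℝ, (∫ r in Set.Ioi |z|, (r : ℂ) * F r) *
      Complex.exp (Complex.I * (‖x‖ * z : ℝ)) = ∫ r, G (z, r) := by
    intro z
    rw [← integral_mul_const, ← integral_indicator measurableSet_Ioi]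
    refine integral_congr_ae (ae_of_all _ fun r => ?_)
    simp [hG, Set.indicator_apply]
  have e2 : ∀ r : ℝ, 0 ≤ r → (r * F r) * ∫ z in -r..r, Complex.exp (Complex.I * (‖x‖ * z : ℝ)) =
      ∫ z, G (z, r) := by
    intro r hr
    rw [intervalIntegral.integral_of_le (by linarith), ← integral_const_mul,
      integral_Ioc_eq_integral_Ioo, ← integral_indicator measurableSet_Ioo]
    refine integral_congr_ae (ae_of_all _ fun z => ?_)
    simp only [hG, Set.indicator_apply, Set.mem_Ioo, Set.mem_ofPred_eq, abs_lt]
  have e3 : ∀ r : ℝ, r ∉ Set.Icc α β → ∫ z, G (z, r) = 0 := by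
    intro r hr
    simp [hG, Set.indicator_apply, hFs r hr]
  calc _ = ∫ z, ∫ r, G (z, r) := by simp_rw [← e1]
    _ = ∫ r, ∫ z, G (z, r) := integral_integral_swap hGi
    _ = ∫ r in Set.Icc α β, ∫ z, G (z, r) := by
        rw [setIntegral_eq_integral_of_forall_compl_eq_zero e3]
    _ = ∫ r in Set.Ioc α β, ∫ z, G (z, r) := integral_Icc_eq_integral_Ioc
    _ = _ := by
        rw [intervalIntegral.integral_of_le hαβ]
        exact setIntegral_congr_fun measurableSet_Ioc fun r hr => by
          rw [← mul_assoc, e2 r (hα.trans hr.1.le)]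

/-! ### The kernel of a thin spherical shell -/

theorem hasDerivAt_sqrt_add_sq {m : ℝ} (hm : 0 < m) (r : ℝ) :
    HasDerivAt (fun r => Real.sqrt (m ^ 2 + r ^ 2)) (r / Real.sqrt (m ^ 2 + r ^ 2)) r := by
  have h : HasDerivAt (fun r => m ^ 2 + r ^ 2) (2 * r) r := by
    simpa using (hasDerivAt_pow 2 r).const_add (m ^ 2)
  refine (h.sqrt (by positivity)).congr_deriv ?_
  have : Real.sqrt (m ^ 2 + r ^ 2) ≠ 0 := (Real.sqrt_pos.2 (by positivity)).ne'
  field_simp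

theorem hasDerivAt_div_sqrt_add_sq {m : ℝ} (hm : 0 < m) (r : ℝ) :
    HasDerivAt (fun r => r / Real.sqrt (m ^ 2 + r ^ 2))
      (m ^ 2 / Real.sqrt (m ^ 2 + r ^ 2) ^ 3) r := by
  have h0 : 0 < Real.sqrt (m ^ 2 + r ^ 2) := Real.sqrt_pos.2 (by positivity)
  refine ((hasDerivAt_id r).div (hasDerivAt_sqrt_add_sq hm r) h0.ne').congr_deriv ?_
  have h1 : Real.sqrt (m ^ 2 + r ^ 2) ^ 2 = m ^ 2 + r ^ 2 := Real.sq_sqrt (by positivity)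
  simp only [id]
  field_simp
  rw [h1]; ring

theorem hasDerivAt_div_sqrt_add_sq_pow {m : ℝ} (hm : 0 < m) (r : ℝ) :
    HasDerivAt (fun r => m ^ 2 / Real.sqrt (m ^ 2 + r ^ 2) ^ 3)
      (-(3 * m ^ 2 * r / Real.sqrt (m ^ 2 + r ^ 2) ^ 5)) r := by
  have h0 : 0 < Real.sqrt (m ^ 2 + r ^ 2) := Real.sqrt_pos.2 (by positivity)
  refine ((hasDerivAt_const r (m ^ 2)).div ((hasDerivAt_sqrt_add_sq hm r).pow 3)
    (pow_pos h0 3).ne').congr_deriv ?_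
  simp only [Nat.cast_ofNat, Pi.pow_apply]
  field_simp
  ring

/-- A `C²` cutoff `ψ` to `[α, β]`, with derivatives `ψ1` and `ψ2`, that varies on the scale
`μ`: each derivative costs a factor `1 / μ`. -/
structure IsShellBump (B μ α β : ℝ) (ψ ψ1 ψ2 : ℝ → ℝ) : Prop where
  hasDerivAt : ∀ r, HasDerivAt ψ (ψ1 r) r
  hasDerivAt1 : ∀ r, HasDerivAt ψ1 (ψ2 r) r
  continuous2 : Continuous ψ2
  eq_zero : ∀ r, r ∉ Set.Ioo α β → ψ r = 0
  eq_zero1 : ∀ r, r ∉ Set.Ioo α β → ψ1 r = 0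
  abs_le : ∀ r, |ψ r| ≤ B
  abs_le1 : ∀ r, |ψ1 r| ≤ B / μ
  abs_le2 : ∀ r, |ψ2 r| ≤ B / μ ^ 2

theorem IsShellBump.continuous {B μ α β : ℝ} {ψ ψ1 ψ2 : ℝ → ℝ}
    (h : IsShellBump B μ α β ψ ψ1 ψ2) : Continuous ψ :=
  continuous_iff_continuousAt.2 fun r => (h.hasDerivAt r).continuousAt

theorem IsShellBump.continuous1 {B μ α β : ℝ} {ψ ψ1 ψ2 : ℝ → ℝ}
    (h : IsShellBump B μ α β ψ ψ1 ψ2) : Continuous ψ1 :=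
  continuous_iff_continuousAt.2 fun r => (h.hasDerivAt1 r).continuousAt

/-- Well inside the light cone the radial phase `c r - τ ⟨r⟩` has no stationary point. -/
theorem norm_radial_integral_le_of_abs_le {m α0 L B : ℝ} (hm : 0 < m) (hα0 : 0 < α0)
    (hL : 1 ≤ L) {μ α β τ c : ℝ} {ψ ψ1 ψ2 : ℝ → ℝ} (hμ : 0 < μ) (hα : α0 ≤ α)
    (hμL : μ ≤ L * α) (hαβ : α ≤ β) (hβ : β ≤ α + 3 * μ)
    (hψ : IsShellBump B μ α β ψ ψ1 ψ2) (hτ : τ ≠ 0)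
    (hc : |c| ≤ α0 / Real.sqrt (m ^ 2 + α0 ^ 2) / 2 * |τ|) :
    ‖∫ r in α..β, Complex.exp (Complex.I * (c * r - τ * Real.sqrt (m ^ 2 + r ^ 2) : ℝ)) *
        (r ^ 2 * ψ r : ℝ)‖ ≤
      72 * B * (2 * L ^ 2 + 4 * (1 + 3 * L) * L + (1 + 3 * L) ^ 2) *
        (1 + 2 * L / (α0 / Real.sqrt (m ^ 2 + α0 ^ 2)) +
          6 * L ^ 2 / (α0 / Real.sqrt (m ^ 2 + α0 ^ 2)) +
          8 * L ^ 2 / (α0 / Real.sqrt (m ^ 2 + α0 ^ 2)) ^ 2) ^ 2 /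
        (α0 / Real.sqrt (m ^ 2 + α0 ^ 2)) ^ 2 * (α ^ 2 / (μ * τ ^ 2)) := by
  set v0 : ℝ := α0 / Real.sqrt (m ^ 2 + α0 ^ 2) with hv0
  have hw : ∀ r, 0 < Real.sqrt (m ^ 2 + r ^ 2) := fun r => Real.sqrt_pos.2 (by positivity)
  have hwsq : ∀ r, Real.sqrt (m ^ 2 + r ^ 2) ^ 2 = m ^ 2 + r ^ 2 :=
    fun r => Real.sq_sqrt (by positivity)
  have hv0p : 0 < v0 := div_pos hα0 (hw _)
  have hαp : 0 < α := hα0.trans_le hα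
  have hτ' : 0 < |τ| := abs_pos.2 hτ
  set R : ℝ := 1 + 3 * L with hR
  have hB : 0 ≤ B := (abs_nonneg _).trans (hψ.abs_le 0)
  have hrR : ∀ r ∈ Set.Icc α β, r ≤ R * α := fun r hr => by
    calc r ≤ α + 3 * μ := hr.2.trans hβ
      _ ≤ α + 3 * (L * α) := by gcongr
      _ = R * α := by rw [hR]; ring
  -- the group velocity and its derivatives
  set v : ℝ → ℝ := fun r => r / Real.sqrt (m ^ 2 + r ^ 2) with hv
  set v1 : ℝ → ℝ := fun r => m ^ 2 / Real.sqrt (m ^ 2 + r ^ 2) ^ 3 with hv1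
  set v2 : ℝ → ℝ := fun r => -(3 * m ^ 2 * r / Real.sqrt (m ^ 2 + r ^ 2) ^ 5) with hv2
  have dv : ∀ r, HasDerivAt v (v1 r) r := hasDerivAt_div_sqrt_add_sq hm
  have dv1 : ∀ r, HasDerivAt v1 (v2 r) r := hasDerivAt_div_sqrt_add_sq_pow hm
  have cv : Continuous v := continuous_iff_continuousAt.2 fun r => (dv r).continuousAt
  have cv1 : Continuous v1 := continuous_iff_continuousAt.2 fun r => (dv1 r).continuousAt
  have cv2 : Continuous v2 := by
    simp only [hv2]
    refine (Continuous.div (by fun_prop) (by fun_prop) fun r => (pow_pos (hw r) 5).ne').neg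
  have hv0v : ∀ r ∈ Set.Icc α β, v0 ≤ v r := fun r hr => by
    have hr0 : α0 ≤ r := hα.trans hr.1
    simp only [hv0, hv]
    rw [div_le_div_iff₀ (hw _) (hw _)]
    refine (sq_le_sq₀ (by positivity) (mul_nonneg (hα0.le.trans hr0) (hw _).le)).1 ?_
    rw [mul_pow, mul_pow, hwsq, hwsq]
    have : α0 ^ 2 ≤ r ^ 2 := by gcongr
    nlinarith [mul_le_mul_of_nonneg_left this (sq_nonneg m)]
  have hrw : ∀ r, r ≤ Real.sqrt (m ^ 2 + r ^ 2) :=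
    fun r => Real.le_sqrt_of_sq_le (by nlinarith [sq_nonneg m])
  have hmw : ∀ r, m ^ 2 ≤ Real.sqrt (m ^ 2 + r ^ 2) ^ 2 :=
    fun r => by rw [hwsq]; nlinarith [sq_nonneg r]
  have hiα : 1 / α ≤ L / μ := by rw [div_le_div_iff₀ hαp hμ]; linarith
  have bv1 : ∀ r ∈ Set.Icc α β, |v1 r| ≤ L / μ := fun r hr => by
    refine le_trans ?_ hiα
    have h1 := hw r
    simp only [hv1]
    rw [abs_of_nonneg (by positivity), div_le_div_iff₀ (by positivity) hαp]
    nlinarith [mul_le_mul (hmw r) (hr.1.trans (hrw r)) hαp.le (sq_nonneg _)]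
  have bv2 : ∀ r ∈ Set.Icc α β, |v2 r| ≤ 3 * (L / μ) ^ 2 := fun r hr => by
    have h1 := hw r
    have hr0 : 0 ≤ r := hαp.le.trans hr.1
    have h3 : |v2 r| ≤ 3 * (1 / α) ^ 2 := by
      simp only [hv2]
      rw [abs_neg, abs_of_nonneg (by positivity), div_pow, one_pow, mul_one_div,
        div_le_div_iff₀ (by positivity) (by positivity)]
      have h4 : m ^ 2 * r ≤ Real.sqrt (m ^ 2 + r ^ 2) ^ 2 * Real.sqrt (m ^ 2 + r ^ 2) :=
        mul_le_mul (hmw r) (hrw r) hr0 (by positivity)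
      have h5 : α ^ 2 ≤ Real.sqrt (m ^ 2 + r ^ 2) ^ 2 :=
        pow_le_pow_left₀ hαp.le (hr.1.trans (hrw r)) 2
      have := mul_le_mul h4 h5 (by positivity) (by positivity)
      nlinarith
    refine h3.trans ?_
    gcongr
  -- the derivative of the phase and its reciprocal
  set p : ℝ → ℝ := fun r => c - τ * v r with hp
  have dp : ∀ r, HasDerivAt p (-(τ * v1 r)) r := fun r => by
    simpa using ((dv r).const_mul τ).const_sub c
  have hpl : ∀ r ∈ Set.Icc α β, v0 / 2 * |τ| ≤ |p r| := fun r hr => by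
    have h1 : v0 * |τ| ≤ |τ * v r| := by
      rw [abs_mul, mul_comm, abs_of_pos (hv0p.trans_le (hv0v r hr))]
      gcongr
      exact hv0v r hr
    have h2 : |τ * v r| ≤ |c| + |p r| := by
      have := abs_sub c (p r)
      have e : c - p r = τ * v r := by simp only [hp]; ring
      rwa [e] at this
    linarith
  have hp0 : ∀ r ∈ Set.Icc α β, p r ≠ 0 := fun r hr =>
    abs_pos.1 ((by positivity : 0 < v0 / 2 * |τ|).trans_le (hpl r hr))
  set D : ℝ := 2 / (v0 * |τ|) with hD
  have hDp : 0 < D := by positivity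
  have hpD : ∀ r ∈ Set.Icc α β, |(p r)⁻¹| ≤ D := fun r hr => by
    rw [abs_inv, hD, inv_le_comm₀ (abs_pos.2 (hp0 r hr)) hDp, hD, inv_div]
    calc _ = v0 / 2 * |τ| := by ring
      _ ≤ _ := hpl r hr
  set M : ℝ := 1 + 2 * L / v0 + 6 * L ^ 2 / v0 + 8 * L ^ 2 / v0 ^ 2 with hM
  have hτD : |τ| * D = 2 / v0 := by rw [hD]; field_simp
  have t1 : 0 ≤ 2 * L / v0 := by positivity
  have t2 : 0 ≤ 6 * L ^ 2 / v0 := by positivity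
  have t3 : 0 ≤ 8 * L ^ 2 / v0 ^ 2 := by positivity
  have key := norm_integral_cexp_le_of_nonstationary (s := μ)
    (φ := fun r => c * r - τ * Real.sqrt (m ^ 2 + r ^ 2)) (p := p) (q := fun r => (p r)⁻¹)
    (q1 := fun r => τ * v1 r * (p r)⁻¹ ^ 2)
    (q2 := fun r => τ * v2 r * (p r)⁻¹ ^ 2 + 2 * τ ^ 2 * v1 r ^ 2 * (p r)⁻¹ ^ 3)
    (a := fun r => r ^ 2 * ψ r) (a1 := fun r => 2 * r * ψ r + r ^ 2 * ψ1 r)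
    (a2 := fun r => (2 * ψ r + 2 * r * ψ1 r) + (2 * r * ψ1 r + r ^ 2 * ψ2 r))
    (Ma := B * (2 * L ^ 2 + 4 * R * L + R ^ 2) * α ^ 2) (Mq := M * D) hαβ hμ
    ?_ ?_ ?_ ?_ ?_ ?_ ?_ ?_ ?_ ?_ ?_ ?_ ?_ ?_ ?_ ?_ ?_ ?_ ?_
  · refine key.trans ?_
    calc _ ≤ 6 * (B * (2 * L ^ 2 + 4 * R * L + R ^ 2) * α ^ 2) * (M * D) ^ 2 / μ ^ 2 * (3 * μ) := by
          gcongr; linarith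
      _ = _ := by
          rw [mul_pow M D, hD, div_pow, mul_pow v0, sq_abs]
          field_simp
          ring
  · intro r _
    exact (((hasDerivAt_id r).const_mul c).sub
      ((hasDerivAt_sqrt_add_sq hm r).const_mul τ)).congr_deriv (by simp [hp, hv])
  · exact (continuous_const.sub (continuous_const.mul cv)).continuousOn
  · exact fun r hr => mul_inv_cancel₀ (hp0 r hr)
  · intro r hr
    refine ((dp r).inv (hp0 r hr)).congr_deriv ?_
    rw [neg_neg, inv_pow]; rfl
  · intro r hr
    have h1 := (((dv1 r).const_mul τ).mul (((dp r).inv (hp0 r hr)).pow 2))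
    refine h1.congr_deriv ?_
    have := hp0 r hr
    simp only [Nat.cast_ofNat, Pi.inv_apply, Pi.pow_apply]
    simp only [pow_one, Nat.add_one_sub_one]
    field_simp
  · have h1 : ContinuousOn (fun r => (p r)⁻¹) (Set.Icc α β) :=
      ContinuousOn.inv₀ (continuous_const.sub (continuous_const.mul cv)).continuousOn hp0
    fun_prop
  · intro r _
    exact ((hasDerivAt_pow 2 r).mul (hψ.hasDerivAt r)).congr_deriv (by simp)
  · intro r _
    exact ((((hasDerivAt_id r).const_mul 2).mul (hψ.hasDerivAt r)).add
      ((hasDerivAt_pow 2 r).mul (hψ.hasDerivAt1 r))).congr_deriv (by simp)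
  · have := hψ.continuous; have := hψ.continuous1; have := hψ.continuous2
    fun_prop
  · simp [hψ.eq_zero α (by simp)]
  · simp [hψ.eq_zero β (by simp)]
  · simp [hψ.eq_zero α (by simp), hψ.eq_zero1 α (by simp)]
  · simp [hψ.eq_zero β (by simp), hψ.eq_zero1 β (by simp)]
  · intro r hr
    refine (hpD r hr).trans (le_mul_of_one_le_left hDp.le ?_)
    linarith
  · intro r hr
    rw [abs_mul, abs_mul, abs_pow]
    calc |τ| * |v1 r| * |(p r)⁻¹| ^ 2 ≤ |τ| * (L / μ) * D ^ 2 := by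
          gcongr
          · exact bv1 r hr
          · exact hpD r hr
      _ = (|τ| * D) * D * L / μ := by ring
      _ = (2 * L / v0) * D / μ := by rw [hτD]; ring
      _ ≤ M * D / μ := by gcongr; linarith
  · intro r hr
    calc _ ≤ |τ| * |v2 r| * |(p r)⁻¹| ^ 2 + 2 * |τ| ^ 2 * |v1 r| ^ 2 * |(p r)⁻¹| ^ 3 := by
          refine (abs_add_le _ _).trans (le_of_eq ?_)
          simp only [abs_mul, abs_pow, abs_two]
      _ ≤ |τ| * (3 * (L / μ) ^ 2) * D ^ 2 + 2 * |τ| ^ 2 * (L / μ) ^ 2 * D ^ 3 := by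
          gcongr
          · exact bv2 r hr
          · exact hpD r hr
          · exact bv1 r hr
          · exact hpD r hr
      _ = (3 * (|τ| * D) + 2 * (|τ| * D) ^ 2) * L ^ 2 * D / μ ^ 2 := by ring
      _ = (6 * L ^ 2 / v0 + 8 * L ^ 2 / v0 ^ 2) * D / μ ^ 2 := by rw [hτD]; ring
      _ ≤ M * D / μ ^ 2 := by gcongr; linarith
  · intro r hr
    have hr0 : 0 ≤ r := hαp.le.trans hr.1
    rw [abs_mul, abs_of_nonneg (sq_nonneg r)]
    calc r ^ 2 * |ψ r| ≤ (R * α) ^ 2 * B := by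
          gcongr
          · exact hrR r hr
          · exact hψ.abs_le r
      _ = B * (0 + 0 + R ^ 2) * α ^ 2 := by ring
      _ ≤ _ := by gcongr <;> positivity
  · intro r hr
    have hr0 : 0 ≤ r := hαp.le.trans hr.1
    calc _ ≤ 2 * r * |ψ r| + r ^ 2 * |ψ1 r| := by
          refine (abs_add_le _ _).trans (le_of_eq ?_)
          simp only [abs_mul, abs_pow, abs_two, abs_of_nonneg hr0]
      _ ≤ 2 * (R * α) * B + (R * α) ^ 2 * (B / μ) := by
          gcongr
          · exact hrR r hr
          · exact hψ.abs_le r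
          · exact hrR r hr
          · exact hψ.abs_le1 r
      _ = (2 * R * α * μ * B + (R * α) ^ 2 * B) / μ := by field_simp
      _ ≤ (2 * R * α * (L * α) * B + (R * α) ^ 2 * B) / μ := by gcongr
      _ = B * (0 + 2 * R * L + R ^ 2) * α ^ 2 / μ := by ring
      _ ≤ _ := by
          gcongr
          · positivity
          · norm_num
  · intro r hr
    have hr0 : 0 ≤ r := hαp.le.trans hr.1
    calc _ ≤ (2 * |ψ r| + 2 * r * |ψ1 r|) + (2 * r * |ψ1 r| + r ^ 2 * |ψ2 r|) := by
          refine (abs_add_le _ _).trans ((add_le_add (abs_add_le _ _) (abs_add_le _ _)).trans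
            (le_of_eq ?_))
          simp only [abs_mul, abs_pow, abs_two, abs_of_nonneg hr0]
      _ ≤ (2 * B + 2 * (R * α) * (B / μ)) +
          (2 * (R * α) * (B / μ) + (R * α) ^ 2 * (B / μ ^ 2)) := by
          gcongr
          · exact hψ.abs_le r
          · exact hrR r hr
          · exact hψ.abs_le1 r
          · exact hrR r hr
          · exact hψ.abs_le1 r
          · exact hrR r hr
          · exact hψ.abs_le2 r
      _ = (2 * B * μ ^ 2 + 4 * (R * α) * B * μ + (R * α) ^ 2 * B) / μ ^ 2 := by field_simp; ring
      _ ≤ (2 * B * (L * α) ^ 2 + 4 * (R * α) * B * (L * α) + (R * α) ^ 2 * B) / μ ^ 2 := by gcongr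
      _ = _ := by ring

/-- The decay of the radial integral due to the curvature `m² / ⟨r⟩³` of the dispersion relation. -/
theorem norm_radial_integral_le_sqrt {m α0 L B : ℝ} (hm : 0 < m) (hα0 : 0 < α0)
    (hL : 1 ≤ L) {μ α β τ c : ℝ} {ψ ψ1 ψ2 : ℝ → ℝ} (hμ : 0 < μ) (hα : α0 ≤ α)
    (hμL : μ ≤ L * α) (hαβ : α ≤ β) (hβ : β ≤ α + 3 * μ)
    (hψ : IsShellBump B μ α β ψ ψ1 ψ2) (hτ : τ ≠ 0) :
    ‖∫ r in α..β, Complex.exp (Complex.I * (c * r - τ * Real.sqrt (m ^ 2 + r ^ 2) : ℝ)) *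
        (r * ψ r : ℝ)‖ ≤
      (2 * Real.pi * (1 + 3 * L) + 3 * (1 + 4 * L)) * B *
        Real.sqrt ((m / α0 + (1 + 3 * L)) ^ 3 / m ^ 2) * (α * Real.sqrt (α ^ 3 / |τ|)) := by
  have hw : ∀ r, 0 < Real.sqrt (m ^ 2 + r ^ 2) := fun r => Real.sqrt_pos.2 (by positivity)
  have hαp : 0 < α := hα0.trans_le hα
  have hτ' : 0 < |τ| := abs_pos.2 hτ
  set R : ℝ := 1 + 3 * L with hR
  set W : ℝ := m / α0 + R with hW
  have hRp : 0 < R := by positivity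
  have hWp : 0 < W := by positivity
  have hB : 0 ≤ B := (abs_nonneg _).trans (hψ.abs_le 0)
  have hrR : ∀ r ∈ Set.Icc α β, r ≤ R * α := fun r hr => by
    calc r ≤ α + 3 * μ := hr.2.trans hβ
      _ ≤ α + 3 * (L * α) := by gcongr
      _ = R * α := by rw [hR]; ring
  have hwW : ∀ r ∈ Set.Icc α β, Real.sqrt (m ^ 2 + r ^ 2) ≤ W * α := fun r hr => by
    have hr0 : 0 ≤ r := hαp.le.trans hr.1
    rw [Real.sqrt_le_left (by positivity)]
    calc m ^ 2 + r ^ 2 ≤ (m + r) ^ 2 := by nlinarith [mul_nonneg hm.le hr0]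
      _ ≤ (W * α) ^ 2 := by
          gcongr
          calc m + r ≤ m / α0 * α + R * α := by
                gcongr
                · rw [div_mul_eq_mul_div, le_div_iff₀ hα0]; gcongr
                · exact hrR r hr
            _ = W * α := by rw [hW]; ring
  set κ : ℝ := |τ| * (m ^ 2 / (W * α) ^ 3) with hκ
  have hκp : 0 < κ := by positivity
  have hv1 : ∀ r ∈ Set.Icc α β, κ ≤ |τ| * (m ^ 2 / Real.sqrt (m ^ 2 + r ^ 2) ^ 3) := fun r hr => by
    have := hw r
    rw [hκ]; gcongr
    exact hwW r hr
  have cv1 : Continuous fun r => m ^ 2 / Real.sqrt (m ^ 2 + r ^ 2) ^ 3 :=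
    continuous_iff_continuousAt.2 fun r => (hasDerivAt_div_sqrt_add_sq_pow hm r).continuousAt
  have main : ∀ c' : ℝ,
      ‖∫ r in α..β, Complex.exp (Complex.I * (c' * r + |τ| * Real.sqrt (m ^ 2 + r ^ 2) : ℝ)) *
        (r * ψ r : ℝ)‖ ≤ (2 * Real.pi * (R * α * B) + (1 + 4 * L) * B * α / μ * (β - α)) /
          Real.sqrt κ := by
    intro c'
    refine norm_integral_cexp_le_of_le_deriv
      (p := fun r => c' + |τ| * (r / Real.sqrt (m ^ 2 + r ^ 2)))
      (p1 := fun r => |τ| * (m ^ 2 / Real.sqrt (m ^ 2 + r ^ 2) ^ 3))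
      (a1 := fun r => ψ r + r * ψ1 r) hαβ hκp ?_ ?_ ?_ hv1 ?_ ?_ ?_ ?_ ?_ ?_
    · intro r _
      exact (((hasDerivAt_id r).const_mul c').add
        ((hasDerivAt_sqrt_add_sq hm r).const_mul |τ|)).congr_deriv (by simp)
    · intro r _
      exact ((hasDerivAt_div_sqrt_add_sq hm r).const_mul |τ|).const_add c'
    · exact (continuous_const.mul cv1).continuousOn
    · intro r _
      exact ((hasDerivAt_id r).mul (hψ.hasDerivAt r)).congr_deriv (by simp)
    · have := hψ.continuous; have := hψ.continuous1
      fun_prop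
    · simp [hψ.eq_zero α (by simp)]
    · simp [hψ.eq_zero β (by simp)]
    · intro r hr
      have hr0 : 0 ≤ r := hαp.le.trans hr.1
      rw [abs_mul, abs_of_nonneg hr0]
      gcongr
      · exact hrR r hr
      · exact hψ.abs_le r
    · intro r hr
      have hr0 : 0 ≤ r := hαp.le.trans hr.1
      calc _ ≤ |ψ r| + r * |ψ1 r| := by
            refine (abs_add_le _ _).trans (le_of_eq ?_)
            rw [abs_mul, abs_of_nonneg hr0]
        _ ≤ B + R * α * (B / μ) := by
            gcongr
            · exact hψ.abs_le r
            · exact hrR r hr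
            · exact hψ.abs_le1 r
        _ = (μ * B + R * α * B) / μ := by field_simp
        _ ≤ (L * α * B + R * α * B) / μ := by gcongr
        _ = _ := by rw [hR]; ring
  have hfin : (2 * Real.pi * (R * α * B) + (1 + 4 * L) * B * α / μ * (β - α)) / Real.sqrt κ ≤
      (2 * Real.pi * R + 3 * (1 + 4 * L)) * B * Real.sqrt (W ^ 3 / m ^ 2) *
        (α * Real.sqrt (α ^ 3 / |τ|)) := by
    have e : 1 / Real.sqrt κ = Real.sqrt (W ^ 3 / m ^ 2) * Real.sqrt (α ^ 3 / |τ|) := by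
      rw [← Real.sqrt_mul (by positivity), one_div, ← Real.sqrt_inv]
      congr 1
      rw [hκ]; field_simp
    calc _ ≤ (2 * Real.pi * (R * α * B) + (1 + 4 * L) * B * α / μ * (3 * μ)) / Real.sqrt κ := by
          gcongr; linarith
      _ = (2 * Real.pi * R + 3 * (1 + 4 * L)) * B * α * (1 / Real.sqrt κ) := by
          field_simp
      _ = _ := by rw [e]; ring
  refine le_trans ?_ hfin
  rcases lt_or_gt_of_ne hτ with h | h
  · refine le_trans (le_of_eq ?_) (main c)
    rw [abs_of_neg h]
    simp only [neg_mul, sub_eq_add_neg]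
  · refine le_trans (le_of_eq ?_) (main (-c))
    rw [abs_of_pos h, ← norm_integral_cexp_neg]
    congr 1
    refine intervalIntegral.integral_congr fun r _ => ?_
    congr 4
    ring

/-- The trivial bound for the radial integral. -/
theorem norm_radial_integral_le {m L B : ℝ} {μ α β τ c : ℝ} {ψ ψ1 ψ2 : ℝ → ℝ} (hαp : 0 < α)
    (hμL : μ ≤ L * α) (hαβ : α ≤ β) (hβ : β ≤ α + 3 * μ)
    (hψ : IsShellBump B μ α β ψ ψ1 ψ2) :
    ‖∫ r in α..β, Complex.exp (Complex.I * (c * r - τ * Real.sqrt (m ^ 2 + r ^ 2) : ℝ)) *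
        (r * ψ r : ℝ)‖ ≤ 3 * (1 + 3 * L) * B * (α * μ) := by
  have hB : 0 ≤ B := (abs_nonneg _).trans (hψ.abs_le 0)
  have h := intervalIntegral.norm_integral_le_of_norm_le_const (a := α) (b := β)
    (C := (1 + 3 * L) * α * B) (f := fun r => Complex.exp (Complex.I *
      (c * r - τ * Real.sqrt (m ^ 2 + r ^ 2) : ℝ)) * (r * ψ r : ℝ)) ?_
  · refine h.trans ?_
    rw [abs_of_nonneg (sub_nonneg.2 hαβ)]
    have h0 : 0 ≤ (1 + 3 * L) * α := by linarith
    calc _ ≤ (1 + 3 * L) * α * B * (3 * μ) := by gcongr; linarith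
      _ = _ := by ring
  · intro r hr
    rw [Set.uIoc_of_le hαβ] at hr
    have hr0 : 0 ≤ r := hαp.le.trans hr.1.le
    rw [norm_mul, norm_cexp_I_mul_ofReal, one_mul, Complex.norm_real, Real.norm_eq_abs, abs_mul,
      abs_of_nonneg hr0]
    have := hr.2
    exact mul_le_mul (by linarith) (hψ.abs_le r) (abs_nonneg _) (by linarith)

/-- The convolution kernel of `S_m(τ)` composed with the radial frequency cutoff `ψ`. -/
noncomputable def shellKernel (m : ℝ) (ψ : ℝ → ℝ) (τ : ℝ) (x : R3) : ℂ :=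
  ∫ ξ : R3, ψ ‖ξ‖ * Complex.exp (Complex.I * (inner ℝ x ξ - τ * bracket m ξ : ℝ))

theorem shellKernel_eq {m B : ℝ} {μ α β τ : ℝ} {ψ ψ1 ψ2 : ℝ → ℝ} (hαp : 0 < α) (hαβ : α ≤ β)
    (hψ : IsShellBump B μ α β ψ ψ1 ψ2) (x : R3) :
    shellKernel m ψ τ x = 2 * Real.pi * ∫ r in α..β,
      (r * (ψ r * Complex.exp (Complex.I * (-τ * Real.sqrt (m ^ 2 + r ^ 2) : ℝ)))) *
        ∫ z in -r..r, Complex.exp (Complex.I * (‖x‖ * z : ℝ)) := by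
  have := hψ.continuous
  rw [← integral_radial_mul_cexp (F := fun r =>
    ψ r * Complex.exp (Complex.I * (-τ * Real.sqrt (m ^ 2 + r ^ 2) : ℝ))) (by fun_prop) hαp.le hαβ]
  · unfold shellKernel bracket
    refine integral_congr_ae (ae_of_all _ fun ξ => ?_)
    simp only
    rw [mul_assoc, ← Complex.exp_add, ← mul_add, ← Complex.ofReal_add]
    congr 4
    ring
  · intro r hr
    rw [hψ.eq_zero r fun h => hr (Set.Ioo_subset_Icc_self h)]
    simp

/-- The shell kernel as an average of radial integrals with phases `|x| s r - τ ⟨r⟩`, where `r s` is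
the height in the direction of `x`. -/
theorem shellKernel_eq_average {m B : ℝ} {μ α β τ : ℝ} {ψ ψ1 ψ2 : ℝ → ℝ} (hαp : 0 < α)
    (hαβ : α ≤ β) (hψ : IsShellBump B μ α β ψ ψ1 ψ2) (x : R3) :
    shellKernel m ψ τ x = 2 * Real.pi * ∫ s in (-1 : ℝ)..1, ∫ r in α..β,
      Complex.exp (Complex.I * (‖x‖ * s * r - τ * Real.sqrt (m ^ 2 + r ^ 2) : ℝ)) *
        (r ^ 2 * ψ r : ℝ) := by
  have := hψ.continuous
  rw [shellKernel_eq hαp hαβ hψ, intervalIntegral_intervalIntegral_swap]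
  · congr 1
    refine intervalIntegral.integral_congr fun r hr => ?_
    have h := intervalIntegral.smul_integral_comp_mul_right (a := -1) (b := 1)
      (fun z : ℝ => Complex.exp (Complex.I * (‖x‖ * z : ℝ))) r
    rw [neg_one_mul, one_mul] at h
    rw [← h, Complex.real_smul, ← mul_assoc, ← intervalIntegral.integral_const_mul]
    refine intervalIntegral.integral_congr fun s _ => ?_
    rw [show ∀ u v w p : ℂ, u * (v * w) * u * p = (w * p) * (u ^ 2 * v) by intros; ring,
      ← Complex.exp_add, ← mul_add, ← Complex.ofReal_add]
    push_cast
    congr 3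
    ring
  · rw [Set.uIoc_of_le (by norm_num), Set.uIoc_of_le hαβ]
    refine IntegrableOn.mono_set ?_
      (Set.prod_mono Set.Ioc_subset_Icc_self Set.Ioc_subset_Icc_self)
    exact ContinuousOn.integrableOn_compact (isCompact_Icc.prod isCompact_Icc)
      (by unfold Function.uncurry; fun_prop)

/-- Integrating over the height first leaves the two phases `± |x| r - τ ⟨r⟩` and gains a factor
`1 / |x|`. -/
theorem shellKernel_eq_sub {m B : ℝ} {μ α β τ : ℝ} {ψ ψ1 ψ2 : ℝ → ℝ} (hαp : 0 < α)
    (hαβ : α ≤ β) (hψ : IsShellBump B μ α β ψ ψ1 ψ2) {x : R3} (hx : x ≠ 0) :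
    shellKernel m ψ τ x = 2 * Real.pi / (Complex.I * ‖x‖) *
      ((∫ r in α..β, Complex.exp (Complex.I * (‖x‖ * r - τ * Real.sqrt (m ^ 2 + r ^ 2) : ℝ)) *
        (r * ψ r : ℝ)) -
      ∫ r in α..β, Complex.exp (Complex.I * (-‖x‖ * r - τ * Real.sqrt (m ^ 2 + r ^ 2) : ℝ)) *
        (r * ψ r : ℝ)) := by
  have := hψ.continuous
  have hx' : Complex.I * ‖x‖ ≠ 0 :=
    mul_ne_zero Complex.I_ne_zero (Complex.ofReal_ne_zero.2 (norm_ne_zero_iff.2 hx))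
  rw [shellKernel_eq hαp hαβ hψ, ← intervalIntegral.integral_sub, div_mul_eq_mul_div, mul_div_assoc,
    ← intervalIntegral.integral_div]
  · congr 1
    refine intervalIntegral.integral_congr fun r hr => ?_
    have h := integral_exp_mul_complex (a := -r) (b := r) hx'
    have e : ∫ z in -r..r, Complex.exp (Complex.I * (‖x‖ * z : ℝ)) =
        ∫ z in -r..r, Complex.exp (Complex.I * ‖x‖ * z) :=
      intervalIntegral.integral_congr fun z _ => by simp [mul_assoc]
    rw [e, h, mul_div_assoc', ← sub_mul]
    congr 1
    have e1 : ∀ c : ℝ, Complex.exp (Complex.I * (c * r - τ * Real.sqrt (m ^ 2 + r ^ 2) : ℝ)) =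
        Complex.exp (Complex.I * (-τ * Real.sqrt (m ^ 2 + r ^ 2) : ℝ)) *
          Complex.exp (Complex.I * c * r) := fun c => by
      rw [← Complex.exp_add]; push_cast; congr 1; ring
    rw [e1, e1]
    push_cast
    ring_nf
  all_goals exact Continuous.intervalIntegrable (by fun_prop) _ _

/-- Dispersive estimate for a shell of radius about `α` and thickness about `μ`: well inside the
light cone there is no stationary point; elsewhere, the angular curvature gives `α μ / |τ|`, and the
radial curvature due to the mass gives `α^{5/2} / |τ|^{3/2}`. -/
theorem exists_norm_shellKernel_le {m α0 L B : ℝ} (hm : 0 < m) (hα0 : 0 < α0) (hL : 1 ≤ L) :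
    ∃ C : ℝ, 0 ≤ C ∧ ∀ (μ α β τ : ℝ) (ψ ψ1 ψ2 : ℝ → ℝ), 0 < μ → α0 ≤ α → μ ≤ L * α → α ≤ β →
      β ≤ α + 3 * μ → IsShellBump B μ α β ψ ψ1 ψ2 → τ ≠ 0 → ∀ x,
      ‖shellKernel m ψ τ x‖ ≤
        C * (α ^ 2 / (μ * τ ^ 2) + α / |τ| * min μ (Real.sqrt (α ^ 3 / |τ|))) := by
  -- `v0` is the least group velocity at frequencies of size at least `α0`
  set v0 : ℝ := α0 / Real.sqrt (m ^ 2 + α0 ^ 2) with hv0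
  have hv0p : 0 < v0 := div_pos hα0 (Real.sqrt_pos.2 (by positivity))
  obtain ⟨C1, hC1⟩ : ∃ C1 : ℝ, C1 = 72 * B * (2 * L ^ 2 + 4 * (1 + 3 * L) * L + (1 + 3 * L) ^ 2) *
        (1 + 2 * L / v0 + 6 * L ^ 2 / v0 + 8 * L ^ 2 / v0 ^ 2) ^ 2 / v0 ^ 2 := ⟨_, rfl⟩
  obtain ⟨C2, hC2⟩ : ∃ C2 : ℝ, C2 = (2 * Real.pi * (1 + 3 * L) + 3 * (1 + 4 * L)) * B *
        Real.sqrt ((m / α0 + (1 + 3 * L)) ^ 3 / m ^ 2) := ⟨_, rfl⟩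
  obtain ⟨C3, hC3⟩ : ∃ C3 : ℝ, C3 = 3 * (1 + 3 * L) * B := ⟨_, rfl⟩
  have hπ := Real.pi_pos
  refine ⟨4 * Real.pi * |C1| + 8 * Real.pi / v0 * (|C2| + |C3|), by positivity,
    fun μ α β τ ψ ψ1 ψ2 hμ hα hμL hαβ hβ hψ hτ x => ?_⟩
  have hαp : 0 < α := hα0.trans_le hα
  have hτ' : 0 < |τ| := abs_pos.2 hτ
  set X : ℝ := α ^ 2 / (μ * τ ^ 2) with hX
  set Y : ℝ := min μ (Real.sqrt (α ^ 3 / |τ|)) with hY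
  have hXp : 0 ≤ X := by positivity
  have hYp : 0 ≤ Y := le_min hμ.le (Real.sqrt_nonneg _)
  rcases le_or_gt ‖x‖ (v0 / 2 * |τ|) with h | h
  · have h1 : ‖shellKernel m ψ τ x‖ ≤ 2 * Real.pi * (|C1| * X * |1 - (-1)|) := by
      rw [shellKernel_eq_average hαp hαβ hψ, norm_mul]
      refine mul_le_mul (by simp [abs_of_pos hπ])
        (intervalIntegral.norm_integral_le_of_norm_le_const fun s hs => ?_) (norm_nonneg _)
        (by positivity)
      rw [Set.uIoc_of_le (by norm_num)] at hs
      refine (norm_radial_integral_le_of_abs_le hm hα0 hL hμ hα hμL hαβ hβ hψ hτ ?_).trans ?_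
      · rw [abs_mul, abs_of_nonneg (norm_nonneg x)]
        refine le_trans (mul_le_of_le_one_right (norm_nonneg x) (abs_le.2 ⟨hs.1.le, hs.2⟩)) h
      · rw [← hv0, ← hC1]
        gcongr
        exact le_abs_self _
    refine h1.trans ?_
    rw [show |(1 : ℝ) - (-1)| = 2 by norm_num]
    calc _ = 4 * Real.pi * |C1| * X := by ring
      _ ≤ (4 * Real.pi * |C1| + 8 * Real.pi / v0 * (|C2| + |C3|)) * (X + α / |τ| * Y) := by
          gcongr
          · exact le_add_of_nonneg_right (by positivity)
          · exact le_add_of_nonneg_right (by positivity)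
  · have hx : 0 < ‖x‖ := lt_trans (by positivity) h
    have hI : ∀ c : ℝ, ‖∫ r in α..β,
        Complex.exp (Complex.I * (c * r - τ * Real.sqrt (m ^ 2 + r ^ 2) : ℝ)) *
          (r * ψ r : ℝ)‖ ≤ (|C2| + |C3|) * (α * Y) := by
      intro c
      rw [hY, mul_min_of_nonneg _ _ hαp.le, mul_min_of_nonneg _ _ (by positivity)]
      refine le_min ?_ ?_
      · refine (norm_radial_integral_le hαp hμL hαβ hβ hψ).trans ?_
        rw [← hC3]
        gcongr
        exact (le_abs_self _).trans (le_add_of_nonneg_left (abs_nonneg _))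
      · refine (norm_radial_integral_le_sqrt hm hα0 hL hμ hα hμL hαβ hβ hψ hτ).trans ?_
        rw [← hC2]
        gcongr
        exact (le_abs_self _).trans (le_add_of_nonneg_right (abs_nonneg _))
    rw [shellKernel_eq_sub hαp hαβ hψ (norm_pos_iff.1 hx), norm_mul]
    have e : ‖2 * (Real.pi : ℂ) / (Complex.I * ‖x‖)‖ = 2 * Real.pi / ‖x‖ := by
      simp [abs_of_pos hπ]
    rw [e]
    calc _ ≤ 2 * Real.pi / (v0 / 2 * |τ|) *
          ((|C2| + |C3|) * (α * Y) + (|C2| + |C3|) * (α * Y)) := by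
          gcongr
          exact (norm_sub_le _ _).trans (add_le_add (hI _) (hI _))
      _ = 8 * Real.pi / v0 * (|C2| + |C3|) * (α / |τ| * Y) := by field_simp; ring
      _ ≤ _ := by
          gcongr
          · exact le_add_of_nonneg_left (by positivity)
          · exact le_add_of_nonneg_left (by positivity)

/-! ### Localization to a ball inside the shell -/

/-- The convolution kernel of `S_m(τ)` composed with the frequency cutoff
`ψ(|ξ|) exp (-|ξ - ξ₀|² / μ²)`. -/
noncomputable def localKernel (m : ℝ) (ψ : ℝ → ℝ) (μ : ℝ) (ξ₀ : R3) (τ : ℝ) (x : R3) : ℂ :=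
  ∫ ξ : R3, (ψ ‖ξ‖ * Real.exp (-(1 / μ ^ 2) * ‖ξ - ξ₀‖ ^ 2) : ℝ) *
    Complex.exp (Complex.I * (inner ℝ x ξ - τ * bracket m ξ : ℝ))

theorem continuous_bracket (m : ℝ) : Continuous (bracket m) := by
  unfold bracket; fun_prop

theorem integrable_exp_neg_mul_norm_sq {b : ℝ} (hb : 0 < b) :
    Integrable fun y : R3 => Real.exp (-b * ‖y‖ ^ 2) := by
  have h := (GaussianFourier.integrable_cexp_neg_mul_sq_norm_add (V := R3) (b := (b : ℂ))
    (by simpa using hb) 0 0).norm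
  refine h.congr (ae_of_all _ fun y => ?_)
  simp only [zero_mul, add_zero]
  rw [Complex.norm_exp]
  congr 1
  norm_cast

/-- The trivial bound, by the integral of the Gaussian. -/
theorem norm_localKernel_le {m : ℝ} {ψ : ℝ → ℝ} {μ : ℝ} (hμ : 0 < μ)
    (hψ1 : ∀ r, |ψ r| ≤ 1) (ξ₀ : R3) (τ : ℝ) (x : R3) :
    ‖localKernel m ψ μ ξ₀ τ x‖ ≤ Real.pi ^ (3 / 2 : ℝ) * μ ^ 3 := by
  have hb : 0 < 1 / μ ^ 2 := by positivity
  have e : Real.pi ^ (3 / 2 : ℝ) * μ ^ 3 =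
      ∫ ξ : R3, Real.exp (-(1 / μ ^ 2) * ‖ξ - ξ₀‖ ^ 2) := by
    rw [integral_sub_right_eq_self (fun ξ : R3 => Real.exp (-(1 / μ ^ 2) * ‖ξ‖ ^ 2)) ξ₀,
      GaussianFourier.integral_rexp_neg_mul_sq_norm hb]
    simp only [finrank_euclideanSpace, Fintype.card_fin, Nat.cast_ofNat]
    rw [div_div_eq_mul_div, div_one, Real.mul_rpow Real.pi_pos.le (by positivity),
      ← Real.rpow_natCast μ 2, ← Real.rpow_mul hμ.le]
    norm_num
  rw [e]
  refine norm_integral_le_of_norm_le ((integrable_exp_neg_mul_norm_sq hb).comp_sub_right ξ₀)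
    (ae_of_all _ fun ξ => ?_)
  rw [norm_mul, norm_cexp_I_mul_ofReal, mul_one, Complex.norm_real, Real.norm_eq_abs, abs_mul,
    abs_of_pos (Real.exp_pos _)]
  exact mul_le_of_le_one_left (Real.exp_pos _).le (hψ1 _)

/-- A Gaussian is a positive average of characters, hence a Gaussian cutoff does not increase the
supremum of a kernel. -/
theorem norm_localKernel_le_of_shellKernel {m : ℝ} {ψ : ℝ → ℝ} {μ : ℝ} (hμ : 0 < μ)
    (hψ : Continuous ψ) (hψc : HasCompactSupport ψ) (ξ₀ : R3) (τ : ℝ) {M : ℝ}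
    (hM : ∀ x, ‖shellKernel m ψ τ x‖ ≤ M) (x : R3) :
    ‖localKernel m ψ μ ξ₀ τ x‖ ≤ M := by
  have hb : 0 < μ ^ 2 / 4 := by positivity
  set N : ℝ := ∫ y : R3, Real.exp (-(μ ^ 2 / 4) * ‖y‖ ^ 2) with hN
  have hNpos : 0 < N := by
    rw [hN, GaussianFourier.integral_rexp_neg_mul_sq_norm hb]
    have := Real.pi_pos
    positivity
  have hgauss : ∀ w : R3, ∫ y : R3, (Real.exp (-(μ ^ 2 / 4) * ‖y‖ ^ 2) : ℂ) *
      Complex.exp (Complex.I * (inner ℝ w y : ℝ)) =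
      N * (Real.exp (-(1 / μ ^ 2) * ‖w‖ ^ 2) : ℂ) := by
    intro w
    have h1 : ∀ w : R3, ∫ y : R3, (Real.exp (-(μ ^ 2 / 4) * ‖y‖ ^ 2) : ℂ) *
        Complex.exp (Complex.I * (inner ℝ w y : ℝ)) =
        (Real.pi / ((μ ^ 2 / 4 : ℝ) : ℂ)) ^ (Module.finrank ℝ R3 / 2 : ℂ) *
          (Real.exp (-(1 / μ ^ 2) * ‖w‖ ^ 2) : ℂ) := by
      intro w
      have h := GaussianFourier.integral_cexp_neg_mul_sq_norm_add (V := R3)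
        (b := ((μ ^ 2 / 4 : ℝ) : ℂ)) (by rwa [Complex.ofReal_re]) Complex.I w
      convert! h using 1
      · refine integral_congr_ae (ae_of_all _ fun y => ?_)
        simp only
        rw [Complex.exp_add]
        push_cast
        rfl
      · rw [Complex.I_sq]
        push_cast
        congr 2
        field_simp
    have h0 := h1 0
    simp only [inner_zero_left, Complex.ofReal_zero, mul_zero, Complex.exp_zero, mul_one,
      norm_zero, ne_eq, OfNat.ofNat_ne_zero, not_false_eq_true, zero_pow, Real.exp_zero,
      Complex.ofReal_one] at h0
    rw [h1 w, ← h0, integral_complex_ofReal]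
  have hshellint : Integrable fun ξ : R3 => ψ ‖ξ‖ := by
    refine Continuous.integrable_of_hasCompactSupport (by fun_prop) ?_
    obtain ⟨R, hR⟩ := hψc.isCompact.isBounded.subset_closedBall 0
    refine HasCompactSupport.of_support_subset_isCompact (isCompact_closedBall (0 : R3) R)
      fun ξ hξ => ?_
    have := hR (subset_tsupport _ hξ)
    simpa using this
  set G : R3 → R3 → ℂ := fun ξ y => (ψ ‖ξ‖ *
    Complex.exp (Complex.I * (inner ℝ x ξ - τ * bracket m ξ : ℝ))) *
    ((Real.exp (-(μ ^ 2 / 4) * ‖y‖ ^ 2) : ℂ) *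
      Complex.exp (Complex.I * (inner ℝ (ξ - ξ₀) y : ℝ))) with hG
  have hGi : Integrable (Function.uncurry G) (volume.prod volume) := by
    refine (hshellint.norm.mul_prod (integrable_exp_neg_mul_norm_sq hb)).mono' ?_ ?_
    · have := continuous_bracket m
      refine Continuous.aestronglyMeasurable ?_
      simp only [hG, Function.uncurry_def]
      fun_prop
    · refine ae_of_all _ fun p => ?_
      simp only [hG, Function.uncurry_def]
      rw [norm_mul, norm_mul, norm_mul, norm_cexp_I_mul_ofReal, norm_cexp_I_mul_ofReal, mul_one,
        mul_one, Complex.norm_real, Complex.norm_real, Real.norm_of_nonneg (Real.exp_pos _).le]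
  have hNK : N * localKernel m ψ μ ξ₀ τ x = ∫ y : R3, ∫ ξ : R3, G ξ y := by
    rw [← integral_integral_swap hGi, localKernel, ← integral_const_mul]
    refine integral_congr_ae (ae_of_all _ fun ξ => ?_)
    simp only [hG]
    rw [integral_const_mul, hgauss]
    push_cast
    ring
  have hin : ∀ y : R3, ‖∫ ξ : R3, G ξ y‖ ≤ M * Real.exp (-(μ ^ 2 / 4) * ‖y‖ ^ 2) := by
    intro y
    have e : ∫ ξ : R3, G ξ y = ((Real.exp (-(μ ^ 2 / 4) * ‖y‖ ^ 2) : ℂ) *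
        Complex.exp (Complex.I * (-inner ℝ ξ₀ y : ℝ))) * shellKernel m ψ τ (x + y) := by
      rw [shellKernel, ← integral_const_mul]
      refine integral_congr_ae (ae_of_all _ fun ξ => ?_)
      simp only [hG]
      rw [show ∀ a b c d e f : ℂ, c * d = e * f → (a * c) * (b * d) = (b * e) * (a * f) by
        intro a b c d e f h; linear_combination a * b * h]
      rw [← Complex.exp_add, ← Complex.exp_add]
      congr 1
      rw [inner_sub_left, inner_add_left, real_inner_comm ξ y]
      push_cast
      ring
    rw [e, norm_mul, norm_mul, norm_cexp_I_mul_ofReal, mul_one, Complex.norm_real,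
      Real.norm_of_nonneg (Real.exp_pos _).le, mul_comm]
    gcongr
    exact hM _
  have hfin : N * ‖localKernel m ψ μ ξ₀ τ x‖ ≤ N * M := by
    calc N * ‖localKernel m ψ μ ξ₀ τ x‖ = ‖N * localKernel m ψ μ ξ₀ τ x‖ := by
          rw [norm_mul, Complex.norm_real, Real.norm_of_nonneg hNpos.le]
      _ ≤ ∫ y : R3, M * Real.exp (-(μ ^ 2 / 4) * ‖y‖ ^ 2) := by
          rw [hNK]
          exact norm_integral_le_of_norm_le ((integrable_exp_neg_mul_norm_sq hb).const_mul M)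
            (ae_of_all _ hin)
      _ = N * M := by rw [integral_const_mul, mul_comm]
  exact le_of_mul_le_mul_left hfin hNpos

/-- A smooth function equal to `1` on `[-1, 1]` and supported in `[-1 - δ, 1 + δ]`, with bounds for
its first two derivatives. -/
theorem exists_bump {δ : ℝ} (hδ : 0 < δ) :
    ∃ (B : ℝ) (f f1 f2 : ℝ → ℝ), (∀ y, HasDerivAt f (f1 y) y) ∧ (∀ y, HasDerivAt f1 (f2 y) y) ∧
      Continuous f2 ∧ (∀ y, 0 ≤ f y) ∧ (∀ y, f y ≤ 1) ∧ (∀ y, |y| ≤ 1 → f y = 1) ∧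
      (∀ y, 1 + δ ≤ |y| → f y = 0) ∧ (∀ y, 1 + δ ≤ |y| → f1 y = 0) ∧
      1 ≤ B ∧ (∀ y, |f1 y| ≤ B) ∧ ∀ y, |f2 y| ≤ B := by
  let f : ContDiffBump (0 : ℝ) := ⟨1, 1 + δ, one_pos, by linarith⟩
  have h0 : ContDiff ℝ 2 f := f.contDiff
  have h1 : ContDiff ℝ 1 (deriv f) := h0.deriv' (n := 1)
  have h2 : Continuous (deriv (deriv f)) := h1.continuous_deriv le_rfl
  obtain ⟨B1, hB1⟩ := f.hasCompactSupport.deriv.exists_bound_of_continuous h1.continuous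
  obtain ⟨B2, hB2⟩ := f.hasCompactSupport.deriv.deriv.exists_bound_of_continuous h2
  have hz : ∀ y, 1 + δ ≤ |y| → f y = 0 := fun y hy => by
    refine f.zero_of_le_dist ?_
    rwa [Real.dist_eq, sub_zero]
  refine ⟨max 1 (max B1 B2), f, deriv f, deriv (deriv f),
    fun y => (h0.differentiable (by norm_num) y).hasDerivAt,
    fun y => (h1.differentiable (by norm_num) y).hasDerivAt, h2, fun y => f.nonneg,
    fun y => f.le_one, fun y hy => ?_, hz, fun y hy => ?_, le_max_left _ _, fun y => ?_,
    fun y => ?_⟩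
  · exact f.one_of_mem_closedBall (by rwa [mem_closedBall_zero_iff])
  · refine IsLocalMin.deriv_eq_zero (Filter.Eventually.of_forall fun z => ?_)
    rw [hz y hy]
    exact f.nonneg
  · exact (hB1 y).trans ((le_max_left _ _).trans (le_max_right _ _))
  · exact (hB2 y).trans ((le_max_right _ _).trans (le_max_right _ _))

/-- Rescaling a bump to the shell `r₁ ≤ r ≤ r₁ + 2 μ`. -/
theorem exists_isShellBump {δ : ℝ} (hδ : 0 < δ) :
    ∃ B : ℝ, ∀ μ r₁ : ℝ, 0 < μ → ∃ ψ ψ1 ψ2 : ℝ → ℝ,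
      IsShellBump B μ (r₁ - δ * μ) (r₁ + 2 * μ + δ * μ) ψ ψ1 ψ2 ∧
      (∀ r, 0 ≤ ψ r) ∧ (∀ r, ψ r ≤ 1) ∧ ∀ r ∈ Set.Icc r₁ (r₁ + 2 * μ), ψ r = 1 := by
  obtain ⟨B, f, f1, f2, hf, hf1, hf2, f_nn, f_le, f_one, f_zero, f1_zero, hB, bf1, bf2⟩ :=
    exists_bump hδ
  refine ⟨B, fun μ r₁ hμ => ⟨fun r => f ((r - (r₁ + μ)) / μ), fun r => f1 ((r - (r₁ + μ)) / μ) / μ,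
    fun r => f2 ((r - (r₁ + μ)) / μ) / μ ^ 2, ⟨?_, ?_, ?_, ?_, ?_, ?_, ?_, ?_⟩, fun r => f_nn _,
    fun r => f_le _, ?_⟩⟩
  · intro r
    have h : HasDerivAt (fun r => (r - (r₁ + μ)) / μ) (1 / μ) r :=
      ((hasDerivAt_id r).sub_const _).div_const μ
    exact ((hf _).comp r h).congr_deriv (by ring)
  · intro r
    have h : HasDerivAt (fun r => (r - (r₁ + μ)) / μ) (1 / μ) r :=
      ((hasDerivAt_id r).sub_const _).div_const μ
    exact (((hf1 _).comp r h).div_const μ).congr_deriv (by ring)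
  · fun_prop
  · intro r hr
    refine f_zero _ ?_
    rw [abs_div, abs_of_pos hμ, le_div_iff₀ hμ, le_abs]
    by_contra! h
    exact hr ⟨by linarith, by linarith⟩
  · intro r hr
    rw [f1_zero, zero_div]
    rw [abs_div, abs_of_pos hμ, le_div_iff₀ hμ, le_abs]
    by_contra! h
    exact hr ⟨by linarith, by linarith⟩
  · intro r
    rw [abs_of_nonneg (f_nn _)]
    exact (f_le _).trans hB
  · intro r
    rw [abs_div, abs_of_pos hμ]
    gcongr
    exact bf1 _
  · intro r
    rw [abs_div, abs_of_pos (pow_pos hμ 2)]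
    gcongr
    exact bf2 _
  · intro r hr
    refine f_one _ ?_
    rw [abs_div, abs_of_pos hμ, div_le_one hμ, abs_le]
    constructor <;> linarith [hr.1, hr.2]

/-! ### Integrability in time -/

theorem lintegral_comp_abs_le {κ : ℝ → ℝ} (hκ0 : ∀ t, 0 ≤ t → 0 ≤ κ t)
    (hκ : IntegrableOn κ (Set.Ioi 0)) {M : ℝ} (hM : ∫ t in Set.Ioi 0, κ t ≤ M) :
    ∫⁻ t, ENNReal.ofReal (κ |t|) ≤ ENNReal.ofReal (2 * M) := by
  have h1 : IntegrableOn (fun t => κ |t|) (Set.Ioi 0) :=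
    hκ.congr_fun (fun t (ht : 0 < t) => by rw [abs_of_pos ht]) measurableSet_Ioi
  have h2 : IntegrableOn (fun t => κ |t|) (Set.Iic 0) := by
    rw [← Measure.map_neg_eq_self (volume : Measure ℝ)]
    have e : MeasurableEmbedding fun t : ℝ => -t := (Homeomorph.neg ℝ).measurableEmbedding
    rw [e.integrableOn_map_iff]
    simp_rw [Function.comp_def, abs_neg, Set.neg_preimage, Set.neg_Iic, neg_zero]
    exact Iff.mpr integrableOn_Ici_iff_integrableOn_Ioi h1
  have hi : Integrable fun t => κ |t| := by
    rw [← integrableOn_univ, ← Set.Iic_union_Ioi (a := (0 : ℝ))]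
    exact h2.union h1
  rw [← ofReal_integral_eq_lintegral_ofReal hi (ae_of_all _ fun t => hκ0 _ (abs_nonneg t)),
    integral_comp_abs]
  exact ENNReal.ofReal_le_ofReal (by linarith)

/-- The profile in time `t = |τ|` of the dispersive bound at frequency `λ = l` and scale `μ`: the
trivial bound for small times, then the sum of the bound without stationary points and of the
interpolated curvature bound. The exponent `-1 - θ` makes the latter integrable at infinity. -/
noncomputable def decayProfile (l μ θ : ℝ) (t : ℝ) : ℝ :=
  if t ≤ l / μ ^ 2 then μ ^ 3
  else l ^ 2 / μ * t ^ (-2 : ℝ) + l * μ * l ^ (3 * θ) * t ^ (-1 - θ)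

theorem decayProfile_nonneg {l μ θ : ℝ} (hl : 0 < l) (hμ : 0 < μ) {t : ℝ} (ht : 0 ≤ t) :
    0 ≤ decayProfile l μ θ t := by
  unfold decayProfile
  split_ifs <;> positivity

theorem measurable_decayProfile (l μ θ : ℝ) : Measurable (decayProfile l μ θ) := by
  unfold decayProfile
  refine Measurable.ite measurableSet_Iic measurable_const ?_
  fun_prop

theorem integral_decayProfile {A l μ θ : ℝ} (hA : 1 ≤ A) (hθ : 0 < θ) (hθ1 : θ ≤ 1 / 2)
    (hl : 0 < l) (hμ : 0 < μ) (hμl : μ ≤ A * l) :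
    IntegrableOn (decayProfile l μ θ) (Set.Ioi 0) ∧
      ∫ t in Set.Ioi 0, decayProfile l μ θ t ≤ 2 * μ * l + A / θ * (μ * l * l ^ (4 * θ)) := by
  set T : ℝ := l / μ ^ 2 with hT
  have hTp : 0 < T := by positivity
  have e1 : Set.EqOn (decayProfile l μ θ) (fun _ => μ ^ 3) (Set.Ioc 0 T) := fun t ht => by
    simp only [decayProfile]; rw [if_pos ht.2]
  have e2 : Set.EqOn (decayProfile l μ θ) (fun t => l ^ 2 / μ * t ^ (-2 : ℝ) +
      l * μ * l ^ (3 * θ) * t ^ (-1 - θ)) (Set.Ioi T) := fun t ht => by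
    simp only [decayProfile]; rw [if_neg (not_le.2 ht)]
  have i1 : IntegrableOn (decayProfile l μ θ) (Set.Ioc 0 T) :=
    (integrableOn_const (by simp)).congr_fun e1.symm measurableSet_Ioc
  have j1 : IntegrableOn (fun t : ℝ => l ^ 2 / μ * t ^ (-2 : ℝ)) (Set.Ioi T) :=
    (integrableOn_Ioi_rpow_of_lt (by norm_num) hTp).const_mul _
  have j2 : IntegrableOn (fun t : ℝ => l * μ * l ^ (3 * θ) * t ^ (-1 - θ)) (Set.Ioi T) :=
    (integrableOn_Ioi_rpow_of_lt (by linarith) hTp).const_mul _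
  have i2 : IntegrableOn (decayProfile l μ θ) (Set.Ioi T) :=
    (j1.add j2).congr_fun e2.symm measurableSet_Ioi
  have hu : Set.Ioc 0 T ∪ Set.Ioi T = Set.Ioi 0 := Set.Ioc_union_Ioi_eq_Ioi hTp.le
  refine ⟨hu ▸ i1.union i2, ?_⟩
  rw [← hu, setIntegral_union (Set.Ioc_disjoint_Ioi le_rfl) measurableSet_Ioi i1 i2,
    setIntegral_congr_fun measurableSet_Ioc e1, setIntegral_congr_fun measurableSet_Ioi e2,
    integral_add j1 j2, integral_const_mul, integral_const_mul,
    integral_Ioi_rpow_of_lt (by norm_num) hTp, integral_Ioi_rpow_of_lt (by linarith) hTp,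
    setIntegral_const]
  have h3 : T ^ (-θ) ≤ A * l ^ θ := by
    have h4 : 1 / T ≤ A ^ 2 * l := by
      rw [hT, one_div_div, div_le_iff₀ hl]
      calc μ ^ 2 ≤ (A * l) ^ 2 := by gcongr
        _ = _ := by ring
    calc T ^ (-θ) = (1 / T) ^ θ := by rw [Real.rpow_neg hTp.le, one_div, Real.inv_rpow hTp.le]
      _ ≤ (A ^ 2 * l) ^ θ := Real.rpow_le_rpow (by positivity) h4 hθ.le
      _ = (A ^ 2) ^ θ * l ^ θ := Real.mul_rpow (by positivity) hl.le
      _ ≤ A * l ^ θ := by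
          gcongr
          rw [← Real.rpow_natCast A 2, ← Real.rpow_mul (by linarith)]
          calc A ^ ((2 : ℕ) * θ) ≤ A ^ (1 : ℝ) :=
                Real.rpow_le_rpow_of_exponent_le hA (by push_cast; linarith)
            _ = A := Real.rpow_one A
  have t1 : volume.real (Set.Ioc 0 T) • μ ^ 3 = μ * l := by
    rw [Real.volume_real_Ioc_of_le hTp.le, smul_eq_mul, hT]; field_simp; ring
  have t2 : l ^ 2 / μ * (-T ^ (-2 + 1 : ℝ) / (-2 + 1)) = μ * l := by
    rw [show (-2 + 1 : ℝ) = -1 by norm_num, Real.rpow_neg_one, hT]; field_simp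
  have t3 : l * μ * l ^ (3 * θ) * (-T ^ (-1 - θ + 1) / (-1 - θ + 1)) ≤
      A / θ * (μ * l * l ^ (4 * θ)) := by
    rw [show -1 - θ + 1 = -θ by ring, neg_div_neg_eq]
    calc _ ≤ l * μ * l ^ (3 * θ) * (A * l ^ θ / θ) := by gcongr
      _ = A / θ * (μ * l * (l ^ (3 * θ) * l ^ θ)) := by ring
      _ = _ := by rw [← Real.rpow_add hl]; ring_nf
  rw [t1, t2]
  linarith

/-- Interpolation between the bounds from the angular and the radial curvature. -/
theorem min_le_rpow_mul_rpow {a b θ : ℝ} (ha : 0 ≤ a) (hb : 0 ≤ b) (h0 : 0 ≤ θ) (h1 : θ ≤ 1) :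
    min a b ≤ a ^ (1 - θ) * b ^ θ := by
  have hm : 0 ≤ min a b := le_min ha hb
  rcases hm.eq_or_lt with h | h
  · rw [← h]; positivity
  calc min a b = min a b ^ (1 - θ) * min a b ^ θ := by
        rw [← Real.rpow_add h]; simp
    _ ≤ _ := by
        have := sub_nonneg.2 h1
        exact mul_le_mul (Real.rpow_le_rpow hm (min_le_left _ _) this)
          (Real.rpow_le_rpow hm (min_le_right _ _) h0) (by positivity) (by positivity)

/-- The curvature bounds `μ` and `(l³ / t)^{1/2}` are interpolated, with weight `2 θ` on the
second. -/
theorem dispersive_le_decayProfile {A l μ α θ t : ℝ} (hA : 1 ≤ A) (hθ : 0 < θ) (hθ1 : θ ≤ 1 / 2)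
    (hl : 0 < l) (hμA : 1 ≤ A * μ) (hμ : 0 < μ) (hα : 0 < α) (hαl : α ≤ A * l) (ht : 0 < t)
    (htT : ¬ t ≤ l / μ ^ 2) :
    α ^ 2 / (μ * t ^ 2) + α / t * min μ (Real.sqrt (α ^ 3 / t)) ≤
      A ^ 4 * decayProfile l μ θ t := by
  have hA0 : 0 < A := by linarith
  rw [decayProfile, if_neg htT, mul_add]
  refine add_le_add ?_ ?_
  · have h1 : (1 : ℝ) ≤ A ^ 2 := one_le_pow₀ hA
    calc α ^ 2 / (μ * t ^ 2) ≤ (A * l) ^ 2 / (μ * t ^ 2) := by gcongr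
      _ = A ^ 2 * 1 * (l ^ 2 / (μ * t ^ 2)) := by ring
      _ ≤ A ^ 2 * A ^ 2 * (l ^ 2 / (μ * t ^ 2)) := by gcongr
      _ = _ := by
          rw [show (-2 : ℝ) = ((-2 : ℤ) : ℝ) by norm_num, Real.rpow_intCast, zpow_neg]
          field_simp
  · have h1 : min μ (Real.sqrt (α ^ 3 / t)) ≤ A ^ 2 * min μ (Real.sqrt (l ^ 3 / t)) := by
      rw [mul_min_of_nonneg _ _ (by positivity)]
      refine min_le_min (le_mul_of_one_le_left hμ.le (one_le_pow₀ hA)) ?_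
      rw [Real.sqrt_le_left (by positivity), mul_pow, Real.sq_sqrt (by positivity)]
      calc α ^ 3 / t ≤ (A * l) ^ 3 / t := by gcongr
        _ = A ^ 3 * (l ^ 3 / t) := by ring
        _ ≤ (A ^ 2) ^ 2 * (l ^ 3 / t) := by
            gcongr
            rw [← pow_mul]
            exact pow_le_pow_right₀ hA (by norm_num)
    have h2 : min μ (Real.sqrt (l ^ 3 / t)) ≤ A * (μ * l ^ (3 * θ) * t ^ (-θ)) := by
      refine (min_le_rpow_mul_rpow hμ.le (Real.sqrt_nonneg _) (by linarith : 0 ≤ 2 * θ)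
        (by linarith)).trans ?_
      have e1 : Real.sqrt (l ^ 3 / t) ^ (2 * θ) = l ^ (3 * θ) * t ^ (-θ) := by
        rw [Real.sqrt_eq_rpow, ← Real.rpow_mul (by positivity), Real.div_rpow (by positivity) ht.le,
          ← Real.rpow_natCast l 3, ← Real.rpow_mul hl.le, Real.rpow_neg ht.le, div_eq_mul_inv]
        congr 2 <;> (push_cast; ring_nf)
      have e2 : μ ^ (1 - 2 * θ) ≤ A * μ := by
        have h3 : μ ^ (-(2 * θ)) ≤ A := by
          rw [Real.rpow_neg hμ.le, ← Real.inv_rpow hμ.le]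
          calc (μ⁻¹) ^ (2 * θ) ≤ A ^ (2 * θ) := by
                refine Real.rpow_le_rpow (by positivity) ?_ (by linarith)
                rw [inv_le_iff_one_le_mul₀ hμ]
                exact hμA
            _ ≤ A ^ (1 : ℝ) := Real.rpow_le_rpow_of_exponent_le hA (by linarith)
            _ = A := Real.rpow_one A
        rw [sub_eq_add_neg, Real.rpow_add hμ, Real.rpow_one, mul_comm]
        gcongr
      rw [e1]
      calc _ ≤ A * μ * (l ^ (3 * θ) * t ^ (-θ)) := by gcongr
        _ = _ := by ring
    calc _ ≤ A * l / t * (A ^ 2 * (A * (μ * l ^ (3 * θ) * t ^ (-θ)))) := by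
          gcongr
          exact h1.trans (by gcongr)
      _ = A ^ 4 * (l * μ * l ^ (3 * θ) * (t⁻¹ * t ^ (-θ))) := by field_simp
      _ = _ := by
          rw [← Real.rpow_neg_one, ← Real.rpow_add ht, ← sub_eq_add_neg]

/-- The dispersive estimate in integrated form: a radial cutoff `ψ` to the shell
`r₁ ≤ r ≤ r₁ + 2 μ`, for which the localized kernels are dominated, uniformly in space, by a
function of time whose integral is at most a multiple of `μ λ^{1 + 2 ε}`. -/
theorem exists_localKernel_le {m ε A : ℝ} (hm : 0 < m) (hε : 0 < ε) (hA : 1 ≤ A) :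
    ∃ C : ℝ, 0 < C ∧ ∀ l μ r₁ : ℝ, 1 ≤ A * μ → μ ≤ A * l → l ≤ A * r₁ → r₁ ≤ A * l →
      ∃ ψ : ℝ → ℝ, Continuous ψ ∧ HasCompactSupport ψ ∧ (∀ r, 0 ≤ ψ r) ∧ (∀ r, ψ r ≤ 1) ∧
        (∀ r ∈ Set.Icc r₁ (r₁ + 2 * μ), ψ r = 1) ∧
        ∃ k : ℝ → ℝ≥0∞, Measurable k ∧ ∫⁻ t, k t ≤ ENNReal.ofReal (C * (μ * l * l ^ (2 * ε))) ∧
          ∀ ξ₀ τ x, ‖localKernel m ψ μ ξ₀ τ x‖ₑ ≤ k τ := by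
  have hA0 : 0 < A := by linarith
  -- with this `δ` the support of the bump stays at a distance at least `l / (2 A)` from the origin
  obtain ⟨B, hB⟩ := exists_isShellBump (δ := 1 / (2 * A ^ 2)) (by positivity)
  obtain ⟨C, hC0, hC⟩ := exists_norm_shellKernel_le (m := m) (α0 := 1 / (2 * A ^ 3))
    (L := 2 * A ^ 2) (B := B) hm (by positivity) (by nlinarith)
  -- the loss in `integral_decayProfile` is `l ^ (4 θ)`
  set θ : ℝ := min (ε / 2) (1 / 2) with hθdef
  have hθ : 0 < θ := lt_min (by linarith) (by norm_num)
  have hθ1 : θ ≤ 1 / 2 := min_le_right _ _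
  have hθε : θ ≤ ε / 2 := min_le_left _ _
  have hπ := Real.pi_pos
  set C1 : ℝ := Real.pi ^ (3 / 2 : ℝ) + C * A ^ 4 with hC1
  have hC1p : 0 < C1 := by positivity
  set E : ℝ := (A ^ 2) ^ (2 * ε) with hE
  have hEp : 0 < E := by positivity
  refine ⟨2 * (C1 * ((2 + A / θ) * E)), by positivity, fun l μ r₁ h1 h2 h3 h4 => ?_⟩
  have hμ : 0 < μ := pos_of_mul_pos_right (by linarith) hA0.le
  have hl : 0 < l := pos_of_mul_pos_right (by linarith) hA0.le
  have hlA : 1 ≤ A ^ 2 * l := by nlinarith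
  set δ : ℝ := 1 / (2 * A ^ 2) with hδ
  have hδp : 0 < δ := by positivity
  have hδ1 : δ ≤ 1 / 2 := by
    rw [hδ, div_le_div_iff₀ (by positivity) (by norm_num)]
    nlinarith
  obtain ⟨ψ, ψ1, ψ2, hψ, ψnn, ψle, ψone⟩ := hB μ r₁ hμ
  set α : ℝ := r₁ - δ * μ with hα
  have hαl : l / (2 * A) ≤ α := by
    have h5 : l / A ≤ r₁ := by rw [div_le_iff₀ hA0]; linarith
    have h6 : δ * μ ≤ l / (2 * A) := by
      calc δ * μ ≤ δ * (A * l) := by gcongr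
        _ = l / (2 * A) := by rw [hδ]; field_simp
    have h7 : l / A = l / (2 * A) + l / (2 * A) := by field_simp; ring
    rw [hα]; linarith
  have hαp : 0 < α := lt_of_lt_of_le (by positivity) hαl
  have hαA : α ≤ A * l := by
    have : 0 < δ * μ := by positivity
    rw [hα]; linarith
  have hα0 : 1 / (2 * A ^ 3) ≤ α := by
    refine le_trans ?_ hαl
    rw [div_le_div_iff₀ (by positivity) (by positivity)]
    nlinarith [mul_le_mul_of_nonneg_left hlA (by positivity : (0 : ℝ) ≤ 2 * A)]
  have hμα : μ ≤ 2 * A ^ 2 * α := by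
    calc μ ≤ A * l := h2
      _ = 2 * A ^ 2 * (l / (2 * A)) := by field_simp
      _ ≤ _ := by gcongr
  have hδμ : δ * μ ≤ 1 / 2 * μ := by gcongr
  have hψc : HasCompactSupport ψ := HasCompactSupport.intro (K := Set.Icc α (r₁ + 2 * μ + δ * μ))
    isCompact_Icc fun r hr => hψ.eq_zero r fun h => hr (Set.Ioo_subset_Icc_self h)
  refine ⟨ψ, hψ.continuous, hψc, ψnn, ψle, ψone,
    fun τ => ENNReal.ofReal (C1 * decayProfile l μ θ |τ|), ?_, ?_, ?_⟩
  · exact ((measurable_decayProfile l μ θ).comp measurable_abs).const_mul C1 |>.ennreal_ofReal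
  · obtain ⟨i1, i2⟩ := integral_decayProfile hA hθ hθ1 hl hμ h2
    have hlE : l ^ (4 * θ) ≤ E * l ^ (2 * ε) := by
      have e1 : l ^ (4 * θ) = l ^ (4 * θ - 2 * ε) * l ^ (2 * ε) := by
        rw [← Real.rpow_add hl]; ring_nf
      rw [e1]
      gcongr
      rw [← neg_sub, Real.rpow_neg hl.le, ← Real.inv_rpow hl.le]
      have h5 : (l⁻¹ : ℝ) ≤ A ^ 2 := by rwa [inv_le_iff_one_le_mul₀ hl]
      calc (l⁻¹) ^ (2 * ε - 4 * θ) ≤ (A ^ 2) ^ (2 * ε - 4 * θ) :=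
            Real.rpow_le_rpow (by positivity) h5 (by linarith)
        _ ≤ E := Real.rpow_le_rpow_of_exponent_le (one_le_pow₀ hA) (by linarith)
    have hone : 1 ≤ E * l ^ (2 * ε) := by
      rw [hE, ← Real.mul_rpow (by positivity) hl.le]
      exact Real.one_le_rpow hlA (by linarith)
    have i3 : 2 * μ * l + A / θ * (μ * l * l ^ (4 * θ)) ≤
        (2 + A / θ) * E * (μ * l * l ^ (2 * ε)) := by
      calc _ ≤ 2 * μ * l * (E * l ^ (2 * ε)) + A / θ * (μ * l * (E * l ^ (2 * ε))) := by
            refine add_le_add (le_mul_of_one_le_right (by positivity) hone) ?_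
            gcongr
        _ = _ := by ring
    simp_rw [ENNReal.ofReal_mul hC1p.le]
    rw [lintegral_const_mul' _ _ ENNReal.ofReal_ne_top]
    refine (mul_le_mul_right (lintegral_comp_abs_le (fun t ht => decayProfile_nonneg hl hμ ht)
      i1 (i2.trans i3)) _).trans ?_
    rw [← ENNReal.ofReal_mul hC1p.le]
    exact ENNReal.ofReal_le_ofReal (le_of_eq (by ring))
  · intro ξ₀ τ x
    rw [← ofReal_norm]
    refine ENNReal.ofReal_le_ofReal ?_
    have hdn := decayProfile_nonneg (θ := θ) hl hμ (abs_nonneg τ)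
    by_cases hτ : |τ| ≤ l / μ ^ 2
    · refine (norm_localKernel_le hμ (fun r => by rw [abs_of_nonneg (ψnn r)]; exact ψle r) ξ₀ τ
        x).trans ?_
      rw [decayProfile, if_pos hτ]
      gcongr
      exact le_add_of_nonneg_right (by positivity)
    · have hτp : 0 < |τ| := lt_trans (by positivity) (not_le.1 hτ)
      refine norm_localKernel_le_of_shellKernel hμ hψ.continuous hψc ξ₀ τ (fun y => ?_) x
      refine (hC μ α _ τ ψ ψ1 ψ2 hμ hα0 hμα ?_ ?_ hψ (abs_pos.1 hτp) y).trans ?_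
      · rw [hα]; nlinarith
      · rw [hα]; linarith
      · rw [← sq_abs τ]
        calc _ ≤ C * (A ^ 4 * decayProfile l μ θ |τ|) := by
              gcongr
              exact dispersive_le_decayProfile hA hθ hθ1 hl h1 hμ hαp hαA hτp hτ
          _ = C * A ^ 4 * decayProfile l μ θ |τ| := by ring
          _ ≤ _ := by
              gcongr
              exact le_add_of_nonneg_left (by positivity)

/-! ### The `TT*` argument -/

theorem mul_le_sq_add_sq_ennreal (a b : ℝ≥0∞) : a * b ≤ a ^ 2 + b ^ 2 := by
  rcases le_total a b with h | h
  · exact (mul_le_mul_left h b).trans ((sq b).ge.trans le_add_self)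
  · exact (mul_le_mul_right h a).trans ((sq a).ge.trans le_self_add)

/-- Schur's test for a convolution kernel. -/
theorem lintegral_lintegral_mul_le {I : Set ℝ} {f k : ℝ → ℝ≥0∞} (hf : Measurable f)
    (hk : Measurable k) :
    ∫⁻ t in I, ∫⁻ s in I, f t * f s * k (t - s) ≤ 2 * (∫⁻ t, k t) * ∫⁻ t in I, f t ^ 2 := by
  have h1 : ∀ t s, f t * f s * k (t - s) ≤ f t ^ 2 * k (t - s) + f s ^ 2 * k (t - s) :=
    fun t s => by rw [← add_mul]; exact mul_le_mul_left (mul_le_sq_add_sq_ennreal _ _) _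
  have e1 : ∀ t, ∫⁻ s in I, k (t - s) ≤ ∫⁻ s, k s := fun t =>
    (setLIntegral_le_lintegral _ _).trans (lintegral_sub_left_eq_self k t).le
  have e2 : ∀ s, ∫⁻ t in I, k (t - s) ≤ ∫⁻ s, k s := fun s =>
    (setLIntegral_le_lintegral _ _).trans (lintegral_sub_right_eq_self k s).le
  have m1 : Measurable fun p : ℝ × ℝ => f p.1 ^ 2 * k (p.1 - p.2) := by fun_prop
  have m2 : Measurable fun p : ℝ × ℝ => f p.2 ^ 2 * k (p.1 - p.2) := by fun_prop
  calc _ ≤ ∫⁻ t in I, ∫⁻ s in I, (f t ^ 2 * k (t - s) + f s ^ 2 * k (t - s)) :=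
        lintegral_mono fun t => lintegral_mono fun s => h1 t s
    _ = ∫⁻ t in I, ((∫⁻ s in I, f t ^ 2 * k (t - s)) + ∫⁻ s in I, f s ^ 2 * k (t - s)) :=
        lintegral_congr fun t => lintegral_add_left (by fun_prop) _
    _ = (∫⁻ t in I, ∫⁻ s in I, f t ^ 2 * k (t - s)) +
          ∫⁻ t in I, ∫⁻ s in I, f s ^ 2 * k (t - s) :=
        lintegral_add_left m1.lintegral_prod_right' _
    _ = (∫⁻ t in I, ∫⁻ s in I, f t ^ 2 * k (t - s)) +
          ∫⁻ s in I, ∫⁻ t in I, f s ^ 2 * k (t - s) := by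
        rw [lintegral_lintegral_swap (f := fun t s => f s ^ 2 * k (t - s)) m2.aemeasurable]
    _ ≤ (∫⁻ t in I, f t ^ 2 * ∫⁻ s, k s) + ∫⁻ s in I, f s ^ 2 * ∫⁻ t, k t := by
        refine add_le_add (lintegral_mono fun t => ?_) (lintegral_mono fun s => ?_)
        · rw [lintegral_const_mul _ (by fun_prop)]
          exact mul_le_mul_right (e1 t) _
        · rw [lintegral_const_mul _ (by fun_prop)]
          exact mul_le_mul_right (e2 s) _
    _ = _ := by
        rw [lintegral_mul_const _ (by fun_prop)]
        ring

section TTStar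

variable {H : Type*} [NormedAddCommGroup H] [InnerProductSpace ℂ H] [CompleteSpace H]

/-- The `TT*` argument along a measurable selection `g` of a family of vectors: if the Gram matrix
of `g` is dominated by a convolution kernel `k`, then `h ↦ ⟪g ·, h⟫` maps `H` to `L²(I)`. -/
theorem lintegral_inner_sq_le {I : Set ℝ} (hIf : volume I ≠ ∞)
    {g : ℝ → H} (hg : StronglyMeasurable g) {c : ℝ} (hc : ∀ t, ‖g t‖ ≤ c)
    {k : ℝ → ℝ≥0∞} (hk : Measurable k) (hgk : ∀ t s, ‖inner ℂ (g t) (g s)‖ₑ ≤ k (t - s)) (h : H) :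
    ∫⁻ t in I, ‖inner ℂ (g t) h‖ₑ ^ 2 ≤ 2 * (∫⁻ t, k t) * ‖h‖ₑ ^ 2 := by
  have hc0 : 0 ≤ c := (norm_nonneg _).trans (hc 0)
  have : IsFiniteMeasure (volume.restrict I) := ⟨by simpa using hIf.lt_top⟩
  set v : ℝ → ℂ := fun t => inner ℂ (g t) h with hv
  have hvm : StronglyMeasurable v := hg.inner stronglyMeasurable_const
  have hvb : ∀ t, ‖v t‖ ≤ c * ‖h‖ := fun t =>
    (norm_inner_le_norm _ _).trans (mul_le_mul_of_nonneg_right (hc t) (norm_nonneg _))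
  have hF : Integrable (fun t => v t • g t) (volume.restrict I) := by
    refine Integrable.of_bound (C := c * ‖h‖ * c) (hvm.smul hg).aestronglyMeasurable
      (ae_of_all _ fun t => ?_)
    rw [norm_smul]
    exact mul_le_mul (hvb t) (hc t) (norm_nonneg _) (by positivity)
  set w : H := ∫ t in I, v t • g t with hw
  set X : ℝ≥0∞ := ∫⁻ t in I, ‖v t‖ₑ ^ 2 with hX
  set K : ℝ≥0∞ := ∫⁻ t, k t with hK
  have hinner : ∀ y : H, inner ℂ y w = ∫ t in I, v t * inner ℂ y (g t) := fun y => by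
    rw [hw, ← integral_inner hF]
    refine integral_congr_ae (ae_of_all _ fun t => ?_)
    simp only
    rw [inner_smul_right]
  have hXtop : X ≠ ∞ := by
    have h1 : X ≤ ∫⁻ t in I, ENNReal.ofReal (c * ‖h‖) ^ 2 := lintegral_mono fun t => by
      gcongr
      rw [← ofReal_norm]
      exact ENNReal.ofReal_le_ofReal (hvb t)
    refine ne_top_of_le_ne_top ?_ h1
    rw [lintegral_const]
    exact ENNReal.mul_ne_top (by simp) (by simpa using hIf)
  have hX1 : X ≤ ‖h‖ₑ * ‖w‖ₑ := by
    have e : inner ℂ h w = ((∫ t in I, ‖v t‖ ^ 2 : ℝ) : ℂ) := by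
      rw [hinner, ← integral_complex_ofReal]
      refine integral_congr_ae (ae_of_all _ fun t => ?_)
      simp only [hv]
      rw [← inner_conj_symm h (g t), RCLike.mul_conj]
      norm_cast
    have e2 : X = ‖inner ℂ h w‖ₑ := by
      rw [e, ← ofReal_norm, Complex.norm_real,
        Real.norm_of_nonneg (integral_nonneg fun t => sq_nonneg _),
        ofReal_integral_eq_lintegral_ofReal _ (ae_of_all _ fun t => sq_nonneg _), hX]
      · refine lintegral_congr fun t => ?_
        rw [ENNReal.ofReal_pow (norm_nonneg _), ofReal_norm]
      · refine Integrable.of_bound (C := (c * ‖h‖) ^ 2) (hvm.norm.pow 2).aestronglyMeasurable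
          (ae_of_all _ fun t => ?_)
        rw [norm_pow, norm_norm]
        have := hvb t
        gcongr
    rw [e2, ← ofReal_norm, ← ofReal_norm, ← ofReal_norm, ← ENNReal.ofReal_mul (norm_nonneg _)]
    exact ENNReal.ofReal_le_ofReal (norm_inner_le_norm _ _)
  have hw2 : ‖w‖ₑ ^ 2 ≤ 2 * K * X := by
    have e1 : ‖w‖ₑ ^ 2 = ‖inner ℂ w w‖ₑ := by
      rw [← ofReal_norm, ← ofReal_norm, ← ENNReal.ofReal_pow (norm_nonneg _),
        inner_self_eq_norm_sq_to_K]
      simp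
    have e2 : ∀ t, ‖inner ℂ w (g t)‖ₑ ≤ ∫⁻ s in I, ‖v s‖ₑ * k (t - s) := fun t => by
      rw [← inner_conj_symm, RCLike.enorm_conj, hinner]
      refine (enorm_integral_le_lintegral_enorm _).trans (lintegral_mono fun s => ?_)
      rw [enorm_mul]
      exact mul_le_mul_right (hgk t s) _
    have hvm' : Measurable fun t => ‖v t‖ₑ := hvm.enorm
    rw [e1, hinner]
    refine (enorm_integral_le_lintegral_enorm _).trans
      (le_trans (lintegral_mono fun t => ?_) (lintegral_lintegral_mul_le hvm' hk))
    rw [enorm_mul]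
    refine (mul_le_mul_right (e2 t) _).trans ?_
    rw [← lintegral_const_mul _ (by fun_prop)]
    simp only [mul_assoc, le_refl]
  -- cancelling `X` is legitimate, because `I` has finite measure and so `X` is finite
  have hX2 : X * X ≤ 2 * K * ‖h‖ₑ ^ 2 * X := by
    calc X * X ≤ (‖h‖ₑ * ‖w‖ₑ) * (‖h‖ₑ * ‖w‖ₑ) := mul_le_mul' hX1 hX1
      _ = ‖h‖ₑ ^ 2 * ‖w‖ₑ ^ 2 := by ring
      _ ≤ ‖h‖ₑ ^ 2 * (2 * K * X) := mul_le_mul_right hw2 _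
      _ = _ := by ring
  rcases eq_or_ne X 0 with h0 | h0
  · rw [h0]; exact zero_le
  · exact (ENNReal.mul_le_mul_iff_left h0 hXtop).1 hX2

/-- A measurable choice of an index at which one of finitely many functions is largest. -/
theorem exists_measurable_argmax {f : ℕ → ℝ → ℝ≥0∞} (hf : ∀ n, Measurable (f n)) (N : ℕ) :
    ∃ j : ℝ → ℕ, Measurable j ∧ ∀ t, ∀ n ≤ N, f n t ≤ f (j t) t := by
  induction N with
  | zero => exact ⟨fun _ => 0, measurable_const, fun t n hn => by simp [Nat.le_zero.1 hn]⟩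
  | succ N ih =>
    obtain ⟨j, hj, hjf⟩ := ih
    have hm : Measurable fun t => f (j t) t :=
      (measurable_from_prod_countable_right (f := fun p : ℕ × ℝ => f p.1 p.2) hf).comp
        (hj.prodMk measurable_id)
    classical
    refine ⟨fun t => if f (j t) t < f (N + 1) t then N + 1 else j t,
      Measurable.ite (measurableSet_lt hm (hf _)) measurable_const hj, fun t n hn => ?_⟩
    simp only
    split_ifs with h
    · rcases Nat.le_succ_iff.1 hn with h1 | h1
      · exact (hjf t n h1).trans h.le
      · rw [h1]
    · rcases Nat.le_succ_iff.1 hn with h1 | h1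
      · exact hjf t n h1
      · rw [h1]; exact not_lt.1 h

/-- The `TT*` argument for the supremum over a countable family: by monotone convergence it is
enough to treat finitely many indices and a bounded time interval. -/
theorem lintegral_iSup_inner_sq_le [SecondCountableTopology H] {e : ℝ → ℕ → H}
    (he : ∀ n, Continuous fun t => e t n) {c : ℝ} (hc : ∀ t n, ‖e t n‖ ≤ c)
    {k : ℝ → ℝ≥0∞} (hk : Measurable k)
    (hek : ∀ t s n n', ‖inner ℂ (e t n) (e s n')‖ₑ ≤ k (t - s)) (h : H) :
    ∫⁻ t, (⨆ n, ‖inner ℂ (e t n) h‖ₑ) ^ 2 ≤ 2 * (∫⁻ t, k t) * ‖h‖ₑ ^ 2 := by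
  set f : ℕ → ℝ → ℝ≥0∞ := fun n t => ‖inner ℂ (e t n) h‖ₑ with hf
  have hfm : ∀ n, Measurable (f n) := fun n => by
    have : Continuous fun t => inner ℂ (e t n) h := (he n).inner continuous_const
    exact this.enorm.measurable
  set F : ℕ → ℝ → ℝ≥0∞ := fun N => (Set.Icc (-(N : ℝ)) N).indicator
    fun t => (⨆ n ≤ N, f n t) ^ 2 with hF
  have hFm : ∀ N, Measurable (F N) := fun N =>
    ((Measurable.iSup fun n => Measurable.iSup fun _ => hfm n).pow_const 2).indicator
      measurableSet_Icc
  have hmono : Monotone F := by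
    intro N M hNM t
    have hNM' : (N : ℝ) ≤ M := by exact_mod_cast hNM
    simp only [hF, Set.indicator_apply]
    split_ifs with h1 h2 h2
    · gcongr ?_ ^ 2
      exact iSup₂_mono' fun n hn => ⟨n, hn.trans hNM, le_rfl⟩
    · exact absurd ⟨by linarith [h1.1], by linarith [h1.2]⟩ h2
    · exact zero_le
    · exact le_rfl
  have hsup : ∀ t, (⨆ n, f n t) ^ 2 ≤ ⨆ N, F N t := by
    intro t
    rw [ENNReal.iSup_pow]
    refine iSup_le fun n => ?_
    obtain ⟨M, hM⟩ := exists_nat_ge |t|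
    refine le_trans ?_ (le_iSup _ (max n M))
    have ht : t ∈ Set.Icc (-((max n M : ℕ) : ℝ)) (max n M : ℕ) := by
      exact abs_le.1 (hM.trans (by exact_mod_cast le_max_right _ _))
    simp only [hF]
    rw [Set.indicator_of_mem ht]
    gcongr
    exact le_iSup₂ (f := fun n (_ : n ≤ max _ M) => f n t) n (le_max_left _ _)
  refine (lintegral_mono hsup).trans ?_
  rw [lintegral_iSup hFm hmono]
  refine iSup_le fun N => ?_
  obtain ⟨j, hj, hjf⟩ := exists_measurable_argmax hfm N
  borelize H
  have hg : StronglyMeasurable fun t => e t (j t) :=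
    ((measurable_from_prod_countable_right (f := fun p : ℕ × ℝ => e p.2 p.1)
      fun n => (he n).measurable).comp (hj.prodMk measurable_id)).stronglyMeasurable
  refine le_trans ?_ (lintegral_inner_sq_le (I := Set.Icc (-(N : ℝ)) N) (by simp)
    hg (fun t => hc t _) hk (fun t s => hek t s _ _) h)
  rw [lintegral_indicator measurableSet_Icc]
  refine lintegral_mono fun t => ?_
  gcongr
  exact iSup₂_le fun n hn => hjf t n hn

end TTStar

/-! ### The inverse Fourier transform on `L¹ ∩ L²` -/

open scoped SchwartzMap ContDiff in
/-- For an integrable `g`, the inverse Fourier transform of `L²`, defined by density, is given by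
the integral. Both sides are compared as distributions. -/
theorem fourierInv_ae_eq (g : L2) (hg : Integrable g) :
    (𝓕⁻ g : L2) =ᵐ[volume] fun x => ∫ η : R3, Complex.exp (↑(2 * Real.pi * inner ℝ η x) *
      Complex.I) * g η := by
  have hexp : ∀ η x : R3, ‖Complex.exp (↑(2 * Real.pi * inner ℝ η x) * Complex.I)‖ = 1 :=
    fun η x => Complex.norm_exp_ofReal_mul_I _
  have hcont : Continuous fun x : R3 => ∫ η : R3, Complex.exp (↑(2 * Real.pi * inner ℝ η x) *
      Complex.I) * g η := by
    refine continuous_of_dominated (bound := fun η => ‖g η‖) (fun x => ?_) (fun x => ?_) hg.norm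
      (ae_of_all _ fun η => by fun_prop)
    · exact (Continuous.aestronglyMeasurable (by fun_prop)).mul hg.aestronglyMeasurable
    · exact ae_of_all _ fun η => by rw [norm_mul, hexp, one_mul]
  refine ae_eq_of_integral_contDiff_smul_eq ((Lp.memLp _).locallyIntegrable one_le_two)
    hcont.locallyIntegrable fun φ hφ hφc => ?_
  have hΦc : HasCompactSupport fun x : R3 => (φ x : ℂ) := hφc.comp_left Complex.ofReal_zero
  have hΦ : ContDiff ℝ ∞ fun x : R3 => (φ x : ℂ) := Complex.ofRealCLM.contDiff.comp hφ
  set Φ : 𝓢(R3, ℂ) := hΦc.toSchwartzMap hΦ with hΦdef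
  have hΦi : Integrable fun x : R3 => (φ x : ℂ) := hΦ.continuous.integrable_of_hasCompactSupport hΦc
  have e1 : ∫ x, φ x • (𝓕⁻ g : L2) x = ∫ η, (𝓕⁻ Φ) η • g η := by
    have h := congrArg (fun T : 𝓢'(R3, ℂ) => T Φ) (Lp.fourierInv_toTemperedDistribution_eq g)
    simp only [TemperedDistribution.fourierInv_apply, Lp.toTemperedDistribution_apply] at h
    rw [h]
    exact integral_congr_ae (ae_of_all _ fun x => rfl)
  set G : R3 → R3 → ℂ := fun η x => (φ x : ℂ) *
    (Complex.exp (↑(2 * Real.pi * inner ℝ η x) * Complex.I) * g η) with hG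
  have hGi : Integrable (Function.uncurry G) (volume.prod volume) := by
    have h := (hg.mul_prod hΦi).bdd_mul
      (f := fun p : R3 × R3 => Complex.exp (↑(2 * Real.pi * inner ℝ p.1 p.2) * Complex.I)) (c := 1)
      (Continuous.aestronglyMeasurable (by fun_prop)) (ae_of_all _ fun p => (hexp _ _).le)
    refine h.congr (ae_of_all _ fun p => ?_)
    simp only [hG, Function.uncurry_def]
    ring
  have e2 : ∫ η, (𝓕⁻ Φ) η • g η = ∫ η, ∫ x, G η x := by
    refine integral_congr_ae (ae_of_all _ fun η => ?_)
    simp only [hG]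
    rw [SchwartzMap.fourierInv_coe, Real.fourierInv_eq', smul_eq_mul, ← integral_mul_const]
    refine integral_congr_ae (ae_of_all _ fun x => ?_)
    simp only [smul_eq_mul]
    rw [real_inner_comm]
    have : Φ x = (φ x : ℂ) := rfl
    rw [this]
    ring
  rw [e1, e2, integral_integral_swap hGi]
  refine integral_congr_ae (ae_of_all _ fun x => ?_)
  simp only [hG]
  rw [integral_const_mul, Complex.real_smul]

/-! ### Frequency-localized evaluation functionals -/

/-- The plane wave `exp (i (x·ξ - t ⟨ξ⟩))` at the frequency `ξ = 2πη`. -/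
noncomputable def planeWave (m t : ℝ) (x η : R3) : ℂ :=
  Complex.exp (Complex.I *
    (inner ℝ x ((2 * Real.pi) • η) - t * bracket m ((2 * Real.pi) • η) : ℝ))

theorem norm_planeWave (m t : ℝ) (x η : R3) : ‖planeWave m t x η‖ = 1 :=
  norm_cexp_I_mul_ofReal _

theorem continuous_planeWave (m t : ℝ) (x : R3) : Continuous (planeWave m t x) := by
  have := continuous_bracket m
  change Continuous fun η => planeWave m t x η
  unfold planeWave
  fun_prop

theorem continuous_planeWave_left (m t : ℝ) (η : R3) : Continuous fun x => planeWave m t x η := by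
  unfold planeWave
  fun_prop

theorem memLp_mul_conj_planeWave {a : R3 → ℝ} (ha : MemLp a 2) (m t : ℝ) (x : R3) :
    MemLp (fun η => (a η : ℂ) * (starRingEnd ℂ) (planeWave m t x η)) 2 := by
  refine MemLp.of_le ha ((Complex.continuous_ofReal.comp_aestronglyMeasurable
    ha.aestronglyMeasurable).mul (Complex.continuous_conj.comp
    (continuous_planeWave m t x)).aestronglyMeasurable) (ae_of_all _ fun η => ?_)
  rw [norm_mul, RCLike.norm_conj, norm_planeWave, mul_one, Complex.norm_real]

/-- The vector of `L²` that represents, through the inner product with `𝓕 f`, the evaluation at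
`(t, x)` of `S_m(t) f` with the frequency cutoff `a`. -/
noncomputable def waveVec {a : R3 → ℝ} (ha : MemLp a 2) (m t : ℝ) (x : R3) : L2 :=
  (memLp_mul_conj_planeWave ha m t x).toLp _

theorem inner_waveVec {a : R3 → ℝ} (ha : MemLp a 2) (m t : ℝ) (x : R3) (g : L2) :
    inner ℂ (waveVec ha m t x) g = ∫ η, (a η : ℂ) * planeWave m t x η * g η := by
  rw [L2.inner_def]
  refine integral_congr_ae ?_
  filter_upwards [(memLp_mul_conj_planeWave ha m t x).coeFn_toLp] with η hη
  rw [waveVec, hη, RCLike.inner_apply']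
  simp

theorem norm_waveVec {a : R3 → ℝ} (ha : MemLp a 2) (m t : ℝ) (x : R3) :
    ‖waveVec ha m t x‖ = (eLpNorm a 2 volume).toReal := by
  rw [waveVec, Lp.norm_toLp]
  congr 1
  refine eLpNorm_congr_norm_ae (ae_of_all _ fun η => ?_)
  rw [norm_mul, RCLike.norm_conj, norm_planeWave, mul_one, Complex.norm_real]

theorem norm_planeWave_sub_le {m W : ℝ} (t s : ℝ) (x η : R3)
    (hW : bracket m ((2 * Real.pi) • η) ≤ W) :
    ‖planeWave m t x η - planeWave m s x η‖ ≤ W * |t - s| := by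
  have hb : 0 ≤ bracket m ((2 * Real.pi) • η) := Real.sqrt_nonneg _
  have e : planeWave m t x η = planeWave m s x η *
      Complex.exp (Complex.I * (-(t - s) * bracket m ((2 * Real.pi) • η) : ℝ)) := by
    unfold planeWave
    rw [← Complex.exp_add, ← mul_add, ← Complex.ofReal_add]
    congr 3
    ring
  rw [e, ← mul_sub_one, norm_mul, norm_planeWave, one_mul]
  refine (Real.norm_exp_I_mul_ofReal_sub_one_le).trans ?_
  rw [Real.norm_eq_abs, abs_mul, abs_neg, abs_of_nonneg hb, mul_comm]
  gcongr

theorem continuous_waveVec {a : R3 → ℝ} (ha : MemLp a 2) (hac : HasCompactSupport a) (m : ℝ)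
    (x : R3) : Continuous fun t => waveVec ha m t x := by
  obtain ⟨W, hW⟩ : ∃ W, ∀ η, a η ≠ 0 → bracket m ((2 * Real.pi) • η) ≤ W := by
    have hc : Continuous fun η : R3 => bracket m ((2 * Real.pi) • η) :=
      (continuous_bracket m).comp (by fun_prop)
    obtain ⟨W, hW⟩ := hac.isCompact.bddAbove_image hc.continuousOn
    exact ⟨W, fun η hη => hW ⟨η, subset_tsupport _ hη, rfl⟩⟩
  have hlip : ∀ t s, dist (waveVec ha m t x) (waveVec ha m s x) ≤
      |W| * (eLpNorm a 2 volume).toReal * dist t s := by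
    intro t s
    rw [dist_eq_norm, Real.dist_eq, ← norm_waveVec ha m 0 0, mul_right_comm]
    refine Lp.norm_le_mul_norm_of_ae_le_mul ?_
    filter_upwards [(memLp_mul_conj_planeWave ha m t x).coeFn_toLp,
      (memLp_mul_conj_planeWave ha m s x).coeFn_toLp,
      (memLp_mul_conj_planeWave ha m 0 0).coeFn_toLp,
      Lp.coeFn_sub (waveVec ha m t x) (waveVec ha m s x)] with η h1 h2 h3 h4
    rw [h4, Pi.sub_apply]
    unfold waveVec
    rw [h1, h2, h3, ← mul_sub, norm_mul, norm_mul, ← map_sub, RCLike.norm_conj, RCLike.norm_conj,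
      norm_planeWave, mul_one, mul_comm]
    by_cases h0 : a η = 0
    · simp [h0]
    · gcongr
      refine (norm_planeWave_sub_le t s x η (hW η h0)).trans ?_
      gcongr
      exact le_abs_self W
  exact (LipschitzWith.of_dist_le_mul (K := ⟨|W| * (eLpNorm a 2 volume).toReal, by positivity⟩)
    hlip).continuous

theorem fourier_S (m t : ℝ) (f : L2) :
    (𝓕 (S m t f) : L2) =ᵐ[volume] fun η => propagatorSymbol m t η * (𝓕 f : L2) η := by
  have : (𝓕 (S m t f) : L2) = (memLp_propagatorSymbol_mul m t (𝓕 f)).toLp _ :=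
    FourierTransform.fourier_fourierInv_eq _
  rw [this]
  exact MemLp.coeFn_toLp _

theorem S_S_neg (m t : ℝ) (f : L2) : S m t (S m (-t) f) = f := by
  have hinj : Function.Injective (𝓕 : L2 → L2) := (Lp.fourierTransformₗᵢ R3 ℂ).injective
  refine hinj (Lp.ext ?_)
  filter_upwards [fourier_S m t (S m (-t) f), fourier_S m (-t) f] with η h1 h2
  rw [h1, h2, ← mul_assoc, propagatorSymbol, propagatorSymbol, ← Complex.exp_add]
  simp

theorem FreqSupportedIn.S {f : L2} {Q : Set R3} (hf : FreqSupportedIn f Q) (m t : ℝ) :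
    FreqSupportedIn (S m t f) Q := by
  filter_upwards [hf, fourier_S m t f] with η h1 h2 hη
  rw [h2, h1 hη, mul_zero]

/-- The sharp frequency cutoff to `Q`, in the variable `η = ξ / 2π`. -/
noncomputable def freqIndicator (Q : Set R3) : R3 → ℝ :=
  Set.indicator {η : R3 | (2 * Real.pi) • η ∈ Q} fun _ => 1

theorem isCompact_setOf_smul_mem {Q : Set R3} (hQ : IsCompact Q) :
    IsCompact {η : R3 | (2 * Real.pi) • η ∈ Q} :=
  (Homeomorph.smulOfNeZero (2 * Real.pi) (by positivity : 2 * Real.pi ≠ 0)).isCompact_preimage.2 hQ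

theorem hasCompactSupport_freqIndicator {Q : Set R3} (hQ : IsCompact Q) :
    HasCompactSupport (freqIndicator Q) :=
  HasCompactSupport.intro (isCompact_setOf_smul_mem hQ) fun _ hη => Set.indicator_of_notMem hη _

theorem memLp_freqIndicator {Q : Set R3} (hQ : IsCompact Q) :
    MemLp (freqIndicator Q) 2 volume :=
  memLp_indicator_const 2 (isCompact_setOf_smul_mem hQ).measurableSet 1
    (Or.inr (isCompact_setOf_smul_mem hQ).measure_lt_top.ne)

/-- For `f` with frequencies in a bounded set, `S_m(t) f` is given by its Fourier integral. -/
theorem S_ae_eq {f : L2} {Q : Set R3} (hQ : IsCompact Q) (hf : FreqSupportedIn f Q) (m t : ℝ) :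
    S m t f =ᵐ[volume] fun x => inner ℂ (waveVec (memLp_freqIndicator hQ) m t x) (𝓕 f : L2) := by
  have ha := memLp_freqIndicator hQ
  set g : L2 := (memLp_propagatorSymbol_mul m t (𝓕 f)).toLp
    (fun η => propagatorSymbol m t η * (𝓕 f : L2) η) with hgdef
  have hg : g =ᵐ[volume] fun η => freqIndicator Q η * (propagatorSymbol m t η * (𝓕 f : L2) η) := by
    filter_upwards [(memLp_propagatorSymbol_mul m t (𝓕 f)).coeFn_toLp, hf] with η h1 h2
    rw [hgdef, h1, freqIndicator]
    by_cases h : (2 * Real.pi) • η ∈ Q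
    · rw [Set.indicator_of_mem (show η ∈ {η : R3 | (2 * Real.pi) • η ∈ Q} from h)]
      simp
    · rw [h2 h]; simp
  have hgi : Integrable g := by
    refine Integrable.congr ?_ hg.symm
    have h := MemLp.integrable_mul (memLp_propagatorSymbol_mul m t (𝓕 f)) ha.ofReal (𝕜 := ℂ)
    refine h.congr (ae_of_all _ fun η => ?_)
    simp [mul_comm]
  have h1 : S m t f = 𝓕⁻ g := rfl
  rw [h1]
  refine (fourierInv_ae_eq g hgi).trans (ae_of_all _ fun x => ?_)
  simp only
  rw [inner_waveVec]
  refine integral_congr_ae ?_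
  filter_upwards [hg] with η hη
  have e : planeWave m t x η =
      Complex.exp (↑(2 * Real.pi * inner ℝ η x) * Complex.I) * propagatorSymbol m t η := by
    simp only [planeWave, propagatorSymbol]
    rw [← Complex.exp_add, inner_smul_right, real_inner_comm]
    congr 1
    push_cast
    ring
  rw [hη, e]
  ring

theorem continuous_inner_waveVec {a : R3 → ℝ} (ha : MemLp a 2) (m t : ℝ) (g : L2) :
    Continuous fun x => inner ℂ (waveVec ha m t x) g := by
  simp_rw [inner_waveVec]
  have hi : Integrable fun η => (a η : ℂ) * g η :=
    MemLp.integrable_mul (𝕜 := ℂ) ha.ofReal (Lp.memLp g)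
  refine continuous_of_dominated (bound := fun η => ‖(a η : ℂ) * g η‖) (fun x => ?_) (fun x => ?_)
    hi.norm (ae_of_all _ fun η => ?_)
  · exact (ha.ofReal.aestronglyMeasurable.mul
      (continuous_planeWave m t x).aestronglyMeasurable).mul (Lp.aestronglyMeasurable g)
  · exact ae_of_all _ fun η => by
      rw [norm_mul, norm_mul, norm_planeWave, mul_one, norm_mul]
  · have := continuous_planeWave_left m t η
    fun_prop

/-- The Fourier integral is continuous in `x`, so the essential supremum is a supremum over a
countable dense set of points. -/
theorem eLpNorm_S_le {f : L2} {Q : Set R3} (hQ : IsCompact Q) (hf : FreqSupportedIn f Q)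
    (m t : ℝ) :
    eLpNorm (S m t f) ∞ volume ≤
      ⨆ n, ‖inner ℂ (waveVec (memLp_freqIndicator hQ) m t (TopologicalSpace.denseSeq R3 n))
        (𝓕 f : L2)‖ₑ := by
  rw [eLpNorm_congr_ae (S_ae_eq hQ hf m t), eLpNorm_exponent_top]
  refine essSup_le_of_ae_le _ (ae_of_all _ fun x => ?_)
  set u : R3 → ℂ := fun x => inner ℂ (waveVec (memLp_freqIndicator hQ) m t x) (𝓕 f : L2) with hu
  have hc : Continuous u := continuous_inner_waveVec (memLp_freqIndicator hQ) m t _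
  have hcl : IsClosed {x | ‖u x‖ₑ ≤ ⨆ n, ‖u (TopologicalSpace.denseSeq R3 n)‖ₑ} :=
    isClosed_le hc.enorm continuous_const
  have hsub : Set.range (TopologicalSpace.denseSeq R3) ⊆
      {x | ‖u x‖ₑ ≤ ⨆ n, ‖u (TopologicalSpace.denseSeq R3 n)‖ₑ} := by
    rintro _ ⟨n, rfl⟩
    exact le_iSup (fun n => ‖u (TopologicalSpace.denseSeq R3 n)‖ₑ) n
  exact (hcl.closure_subset_iff.2 hsub) (TopologicalSpace.denseRange_denseSeq R3 x)

/-! ### Strichartz estimates -/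

theorem IsCube.isCompact {s : ℝ} {Q : Set R3} (hQ : IsCube s Q) : IsCompact Q := by
  obtain ⟨g, rfl⟩ := hQ
  refine IsCompact.image ?_ g.continuous
  have h : IsCompact (Set.univ.pi fun _ : Fin 3 => Set.Icc (0 : ℝ) s) :=
    isCompact_univ_pi fun _ => isCompact_Icc
  have := h.image (PiLp.continuous_toLp 2 fun _ : Fin 3 => ℝ)
  convert! this using 1
  ext x
  refine ⟨fun hx => ⟨x.ofLp, fun i _ => hx i, rfl⟩, ?_⟩
  rintro ⟨y, hy, rfl⟩ i
  exact hy i trivial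

theorem IsCube.nonempty {s : ℝ} (hs : 0 ≤ s) {Q : Set R3} (hQ : IsCube s Q) : Q.Nonempty := by
  obtain ⟨g, rfl⟩ := hQ
  exact ⟨g 0, 0, fun i => ⟨le_rfl, hs⟩, rfl⟩

theorem IsCube.norm_sub_le {s : ℝ} (hs : 0 ≤ s) {Q : Set R3} (hQ : IsCube s Q) {ξ ζ : R3}
    (hξ : ξ ∈ Q) (hζ : ζ ∈ Q) : ‖ξ - ζ‖ ≤ 2 * s := by
  obtain ⟨g, rfl⟩ := hQ
  obtain ⟨x, hx, rfl⟩ := hξ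
  obtain ⟨y, hy, rfl⟩ := hζ
  rw [← dist_eq_norm, g.isometry.dist_eq, EuclideanSpace.dist_eq]
  rw [Real.sqrt_le_left (by positivity)]
  have h : ∀ i : Fin 3, dist (x i) (y i) ^ 2 ≤ s ^ 2 := fun i => by
    have h1 := hx i
    have h2 := hy i
    have : dist (x i) (y i) ≤ s := by
      rw [Real.dist_eq, abs_le]
      constructor <;> linarith [h1.1, h1.2, h2.1, h2.2]
    gcongr
  calc ∑ i, dist (x i) (y i) ^ 2 ≤ ∑ _i : Fin 3, s ^ 2 := Finset.sum_le_sum fun i _ => h i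
    _ = 3 * s ^ 2 := by simp
    _ ≤ (2 * s) ^ 2 := by nlinarith [sq_nonneg s]

/-- The square root, in the variable `η = ξ / 2π`, of the frequency cutoff of `localKernel`. -/
noncomputable def cutoff (ψ : ℝ → ℝ) (μ : ℝ) (ξ₀ η : R3) : ℝ :=
  Real.sqrt (ψ ‖(2 * Real.pi) • η‖ *
    Real.exp (-(1 / μ ^ 2) * ‖(2 * Real.pi) • η - ξ₀‖ ^ 2))

theorem hasCompactSupport_cutoff {ψ : ℝ → ℝ} (hψc : HasCompactSupport ψ) (μ : ℝ) (ξ₀ : R3) :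
    HasCompactSupport (cutoff ψ μ ξ₀) := by
  obtain ⟨R, hR⟩ := hψc.isCompact.isBounded.subset_closedBall 0
  refine HasCompactSupport.of_support_subset_isCompact (isCompact_closedBall (0 : R3) R)
    fun η hη => ?_
  have h1 : ψ ‖(2 * Real.pi) • η‖ ≠ 0 := fun h => hη (by simp only [cutoff]; simp [h])
  have h2 := hR (subset_tsupport _ h1)
  rw [mem_closedBall_zero_iff, norm_norm, norm_smul] at h2
  rw [mem_closedBall_zero_iff]
  refine le_trans (le_mul_of_one_le_left (norm_nonneg _) ?_) h2
  rw [Real.norm_of_nonneg (by positivity)]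
  linarith [Real.two_le_pi]

theorem continuous_cutoff {ψ : ℝ → ℝ} (hψ : Continuous ψ) (μ : ℝ) (ξ₀ : R3) :
    Continuous (cutoff ψ μ ξ₀) := by
  change Continuous fun η => cutoff ψ μ ξ₀ η
  unfold cutoff
  fun_prop

/-- The Gram matrix of the wave vectors with cutoff `cutoff ψ μ ξ₀` is the kernel `localKernel`. -/
theorem inner_waveVec_waveVec {m : ℝ} {ψ : ℝ → ℝ} (hψ0 : ∀ r, 0 ≤ ψ r) {μ : ℝ} {ξ₀ : R3}
    (ha : MemLp (cutoff ψ μ ξ₀) 2) (t s : ℝ) (x y : R3) :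
    inner ℂ (waveVec ha m t x) (waveVec ha m s y) =
      ((|((2 * Real.pi) ^ 3)⁻¹| : ℝ) : ℂ) * localKernel m ψ μ ξ₀ (t - s) (x - y) := by
  have h := Measure.integral_comp_smul (volume : Measure R3)
    (fun ξ : R3 => ((ψ ‖ξ‖ * Real.exp (-(1 / μ ^ 2) * ‖ξ - ξ₀‖ ^ 2) : ℝ) : ℂ) *
      Complex.exp (Complex.I * (inner ℝ (x - y) ξ - (t - s) * bracket m ξ : ℝ))) (2 * Real.pi)
  rw [finrank_euclideanSpace, Fintype.card_fin, Complex.real_smul] at h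
  rw [localKernel, ← h, inner_waveVec]
  refine integral_congr_ae ?_
  filter_upwards [(memLp_mul_conj_planeWave ha m s y).coeFn_toLp] with η hη
  rw [waveVec, hη]
  have hsq : (cutoff ψ μ ξ₀ η : ℂ) * cutoff ψ μ ξ₀ η = ((ψ ‖(2 * Real.pi) • η‖ *
      Real.exp (-(1 / μ ^ 2) * ‖(2 * Real.pi) • η - ξ₀‖ ^ 2) : ℝ) : ℂ) := by
    rw [← Complex.ofReal_mul, cutoff, Real.mul_self_sqrt (mul_nonneg (hψ0 _) (Real.exp_pos _).le)]
  have hpw : planeWave m t x η * (starRingEnd ℂ) (planeWave m s y η) =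
      Complex.exp (Complex.I * (inner ℝ (x - y) ((2 * Real.pi) • η) -
        (t - s) * bracket m ((2 * Real.pi) • η) : ℝ)) := by
    unfold planeWave
    rw [← Complex.exp_conj, ← Complex.exp_add]
    congr 1
    rw [map_mul, Complex.conj_I, Complex.conj_ofReal, inner_sub_left]
    push_cast
    ring
  rw [← hsq, ← hpw]
  ring

/-- The homogeneous estimate, for the evaluation functionals localized to `Q`. The kernel bounds
are available only for the smooth cutoff; dividing by it costs at most a factor `exp 2` on `Q`. -/
theorem exists_lintegral_iSup_inner_waveVec_le {m ε A : ℝ} (hm : 0 < m) (hε : 0 < ε)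
    (hA : 1 ≤ A) :
    ∃ C : ℝ, 0 < C ∧ ∀ (l μ : ℝ) (Q : Set R3) (hQ : IsCube μ Q), 1 ≤ A * μ → μ ≤ A * l →
      l ≤ A * Metric.infDist 0 Q → Metric.infDist 0 Q ≤ A * l → ∀ g : L2,
        ∫⁻ t, (⨆ n, ‖inner ℂ (waveVec (memLp_freqIndicator hQ.isCompact) m t
          (TopologicalSpace.denseSeq R3 n)) g‖ₑ) ^ 2 ≤
            ENNReal.ofReal (C * (μ * l * l ^ (2 * ε))) * ‖g‖ₑ ^ 2 := by
  obtain ⟨C, hC0, hC⟩ := exists_localKernel_le (m := m) hm hε hA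
  refine ⟨2 * C * Real.exp 2 ^ 2, by positivity, fun l μ Q hQ h1 h2 h3 h4 g => ?_⟩
  have hA0 : 0 < A := by linarith
  have hμ : 0 < μ := pos_of_mul_pos_right (by linarith) hA0.le
  have hl : 0 < l := pos_of_mul_pos_right (by linarith) hA0.le
  set r₁ : ℝ := Metric.infDist 0 Q with hr₁
  obtain ⟨ψ, ψcont, ψc, ψnn, ψle, ψone, k, hk, hkint, hker⟩ := hC l μ r₁ h1 h2 h3 h4
  obtain ⟨ξ₀, hξ₀, hξ₀d⟩ := hQ.isCompact.exists_infDist_eq_dist (hQ.nonempty hμ.le) 0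
  have hnorm : ∀ ξ ∈ Q, ‖ξ‖ ∈ Set.Icc r₁ (r₁ + 2 * μ) := fun ξ hξ => by
    constructor
    · have := Metric.infDist_le_dist_of_mem (x := (0 : R3)) hξ
      rwa [dist_zero_left] at this
    · rw [hr₁, hξ₀d, dist_zero_left]
      calc ‖ξ‖ ≤ ‖ξ₀‖ + ‖ξ - ξ₀‖ := norm_le_norm_add_norm_sub' ξ ξ₀
        _ ≤ _ := by gcongr; exact hQ.norm_sub_le hμ.le hξ hξ₀
  set P : Set R3 := {η : R3 | (2 * Real.pi) • η ∈ Q} with hP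
  have hPc : IsCompact P := isCompact_setOf_smul_mem hQ.isCompact
  have hPm : MeasurableSet P := hPc.measurableSet
  have ha := memLp_freqIndicator hQ.isCompact
  have hχ : MemLp (cutoff ψ μ ξ₀) 2 volume :=
    (continuous_cutoff ψcont μ ξ₀).memLp_of_hasCompactSupport (hasCompactSupport_cutoff ψc μ ξ₀)
  have hlow : ∀ η ∈ P, Real.exp (-2) ≤ cutoff ψ μ ξ₀ η := fun η hη => by
    rw [cutoff, ψone _ (hnorm _ hη), one_mul]
    refine Real.le_sqrt_of_sq_le ?_
    rw [← Real.exp_nat_mul]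
    refine Real.exp_le_exp.2 ?_
    have h5 := hQ.norm_sub_le hμ.le hη hξ₀
    have h6 : ‖(2 * Real.pi) • η - ξ₀‖ ^ 2 ≤ (2 * μ) ^ 2 := by gcongr
    calc ((2 : ℕ) : ℝ) * -2 = -(1 / μ ^ 2) * (2 * μ) ^ 2 := by field_simp; norm_num
      _ ≤ _ := by rw [neg_mul, neg_mul]; gcongr
  -- `h = b g` has the same inner products with the smoothly cut off vectors as `g` with the
  -- sharply cut off ones
  set b : R3 → ℝ := P.indicator fun η => (cutoff ψ μ ξ₀ η)⁻¹ with hb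
  have hbm : Measurable b := (continuous_cutoff ψcont μ ξ₀).measurable.inv.indicator hPm
  have hbb : ∀ η, ‖b η‖ ≤ Real.exp 2 := fun η => by
    rw [hb]
    by_cases hη : η ∈ P
    · rw [Set.indicator_of_mem hη, norm_inv,
        Real.norm_of_nonneg ((Real.exp_pos _).trans_le (hlow η hη)).le]
      rw [inv_le_comm₀ ((Real.exp_pos _).trans_le (hlow η hη)) (Real.exp_pos _), ← Real.exp_neg]
      exact hlow η hη
    · rw [Set.indicator_of_notMem hη, norm_zero]; positivity
  have hbg : ∀ η, ‖(b η : ℂ) * g η‖ ≤ Real.exp 2 * ‖g η‖ := fun η => by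
    rw [norm_mul, Complex.norm_real]
    gcongr
    exact hbb η
  have hh : MemLp (fun η => (b η : ℂ) * g η) 2 volume :=
    (Lp.memLp g).of_le_mul ((Complex.measurable_ofReal.comp hbm).aestronglyMeasurable.mul
      (Lp.aestronglyMeasurable g)) (ae_of_all _ hbg)
  set h : L2 := hh.toLp _ with hhdef
  have hhn : ‖h‖ ≤ Real.exp 2 * ‖g‖ := by
    refine Lp.norm_le_mul_norm_of_ae_le_mul ?_
    filter_upwards [hh.coeFn_toLp] with η hη
    rw [hhdef, hη]
    exact hbg η
  have hinner : ∀ t x, inner ℂ (waveVec (memLp_freqIndicator hQ.isCompact) m t x) g =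
      inner ℂ (waveVec hχ m t x) h := fun t x => by
    rw [inner_waveVec, inner_waveVec]
    refine integral_congr_ae ?_
    filter_upwards [hh.coeFn_toLp] with η hη
    rw [hhdef, hη, hb, freqIndicator]
    by_cases hηP : η ∈ P
    · rw [Set.indicator_of_mem hηP, Set.indicator_of_mem hηP]
      have h0 : (cutoff ψ μ ξ₀ η : ℂ) ≠ 0 :=
        Complex.ofReal_ne_zero.2 ((Real.exp_pos _).trans_le (hlow η hηP)).ne'
      push_cast
      field_simp
    · rw [Set.indicator_of_notMem hηP, Set.indicator_of_notMem hηP]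
      simp
  simp_rw [hinner]
  have : Fact ((2 : ℝ≥0∞) ≠ ∞) := ⟨ENNReal.ofNat_ne_top⟩
  refine (lintegral_iSup_inner_sq_le (e := fun t n => waveVec hχ m t
    (TopologicalSpace.denseSeq R3 n))
    (fun n => continuous_waveVec hχ (hasCompactSupport_cutoff ψc μ ξ₀) m _)
    (fun t n => (norm_waveVec hχ m t _).le) hk (fun t s n n' => ?_) h).trans ?_
  · rw [inner_waveVec_waveVec ψnn, enorm_mul]
    refine le_trans (mul_le_of_le_one_left zero_le ?_) (hker ξ₀ (t - s) _)
    rw [← ofReal_norm, Complex.norm_real, Real.norm_eq_abs, abs_abs, abs_inv,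
      abs_of_nonneg (by positivity)]
    refine ENNReal.ofReal_le_one.2 (inv_le_one_of_one_le₀ (one_le_pow₀ ?_))
    linarith [Real.two_le_pi]
  · have e1 : ‖h‖ₑ ≤ ENNReal.ofReal (Real.exp 2) * ‖g‖ₑ := by
      rw [← ofReal_norm, ← ofReal_norm, ← ENNReal.ofReal_mul (Real.exp_pos _).le]
      exact ENNReal.ofReal_le_ofReal hhn
    calc _ ≤ 2 * ENNReal.ofReal (C * (μ * l * l ^ (2 * ε))) *
          (ENNReal.ofReal (Real.exp 2) * ‖g‖ₑ) ^ 2 := by gcongr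
      _ = ENNReal.ofReal 2 * ENNReal.ofReal (C * (μ * l * l ^ (2 * ε))) *
          ENNReal.ofReal (Real.exp 2 ^ 2) * ‖g‖ₑ ^ 2 := by
          rw [mul_pow, ENNReal.ofReal_pow (Real.exp_pos _).le, ENNReal.ofReal_ofNat]
          ring
      _ = _ := by
          rw [← ENNReal.ofReal_mul (by norm_num), ← ENNReal.ofReal_mul (by positivity)]
          congr 2
          ring

/-! ### Transfer to `U²` -/

/-- Cauchy–Schwarz for a weighted series, up to a factor `2`. -/
theorem tsum_mul_sq_le (c x : ℕ → ℝ≥0∞) :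
    (∑' j, c j * x j) ^ 2 ≤ 2 * (∑' j, c j) * ∑' j, c j * x j ^ 2 := by
  calc (∑' j, c j * x j) ^ 2 = ∑' i, ∑' j, (c i * x i) * (c j * x j) := by
        rw [sq, ← ENNReal.tsum_mul_right]
        simp_rw [ENNReal.tsum_mul_left]
    _ ≤ ∑' i, ∑' j, (c i * x i ^ 2 * c j + c i * (c j * x j ^ 2)) := by
        refine ENNReal.tsum_le_tsum fun i => ENNReal.tsum_le_tsum fun j => ?_
        calc (c i * x i) * (c j * x j) = c i * c j * (x i * x j) := by ring
          _ ≤ c i * c j * (x i ^ 2 + x j ^ 2) := by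
              gcongr
              exact mul_le_sq_add_sq_ennreal _ _
          _ = _ := by ring
    _ = _ := by
        simp_rw [ENNReal.tsum_add, ENNReal.tsum_mul_left, ENNReal.tsum_mul_right]
        ring

/-- At each time a `U^p`-atom takes the value of one of its steps, or vanishes. -/
theorem eq_or_eq_zero_of_step {K : ℕ} {τ : Fin (K + 1) → EReal} (hτ : StrictMono τ)
    (φ : Fin K → L2) (s : EReal) :
    (∃ k, ∑ k : Fin K, Set.indicator (Set.Ico (τ k.castSucc) (τ k.succ)) (fun _ => φ k) s = φ k) ∨
      ∑ k : Fin K, Set.indicator (Set.Ico (τ k.castSucc) (τ k.succ)) (fun _ => φ k) s = 0 := by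
  by_cases h : ∃ k : Fin K, s ∈ Set.Ico (τ k.castSucc) (τ k.succ)
  · obtain ⟨k, hk⟩ := h
    refine Or.inl ⟨k, ?_⟩
    rw [Finset.sum_eq_single k, Set.indicator_of_mem hk]
    · intro i _ hik
      refine Set.indicator_of_notMem (fun hi => ?_) _
      rcases lt_or_gt_of_ne hik with h1 | h1
      · have : τ i.succ ≤ τ k.castSucc := hτ.monotone (by
          rw [Fin.le_def, Fin.val_succ, Fin.val_castSucc]; exact h1)
        exact absurd (hi.2.trans_le (this.trans hk.1)) (lt_irrefl s)
      · have : τ k.succ ≤ τ i.castSucc := hτ.monotone (by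
          rw [Fin.le_def, Fin.val_succ, Fin.val_castSucc]; exact h1)
        exact absurd (hk.2.trans_le (this.trans hi.1)) (lt_irrefl s)
    · simp
  · refine Or.inr (Finset.sum_eq_zero fun k _ => Set.indicator_of_notMem (fun hk => h ⟨k, hk⟩) _)

/-- The transfer principle in an abstract form: a bound for a supremum of continuous families of
functionals applied to constant vectors passes to `U²`. The `L²` bound is summed over the steps of
an atom, and then over the atoms. -/
theorem lintegral_iSup_inner_sq_le_of_isURepr {d : ℝ → ℕ → L2}
    (hd : ∀ g : L2, ∀ n, Measurable fun t => ‖inner ℂ (d t n) (𝓕 g : L2)‖ₑ) {M : ℝ≥0∞}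
    (hM : ∀ g : L2, ∫⁻ t, (⨆ n, ‖inner ℂ (d t n) (𝓕 g : L2)‖ₑ) ^ 2 ≤ M * ‖g‖ₑ ^ 2)
    {w : ℝ → L2} {c : ℕ → ℂ} {a : ℕ → ℝ → L2} (hr : IsURepr 2 w c a) :
    ∫⁻ t, (⨆ n, ‖inner ℂ (d t n) (𝓕 (w t) : L2)‖ₑ) ^ 2 ≤ 2 * M * (∑' j, ‖c j‖ₑ) ^ 2 := by
  obtain ⟨hatom, -, hsum⟩ := hr
  set N : ℝ → L2 → ℝ≥0∞ := fun t g => ⨆ n, ‖inner ℂ (d t n) (𝓕 g : L2)‖ₑ with hN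
  have hNm : ∀ g, Measurable fun t => N t g := fun g => Measurable.iSup fun n => hd g n
  have hatomN : ∀ j, ∃ G : ℝ → ℝ≥0∞, Measurable G ∧ (∀ t, N t (a j t) ^ 2 ≤ G t) ∧
      ∫⁻ t, G t ≤ M := by
    intro j
    obtain ⟨K, τ, φ, hτ, -, hφ, haj⟩ := hatom j
    refine ⟨fun t => ∑ k, N t (φ k) ^ 2, by fun_prop, fun t => ?_, ?_⟩
    · rw [haj t]
      rcases eq_or_eq_zero_of_step hτ φ t with ⟨k, hk⟩ | h0
      · rw [hk]
        exact Finset.single_le_sum (f := fun k => N t (φ k) ^ 2) (fun _ _ => zero_le)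
          (Finset.mem_univ k)
      · rw [h0]
        have h00 : (𝓕 (0 : L2) : L2) = 0 := (Lp.fourierTransformₗᵢ R3 ℂ).map_zero
        simp only [hN, h00, inner_zero_right, enorm_zero, iSup_const]
        simp
    · rw [lintegral_finsetSum _ fun k _ => (hNm (φ k)).pow_const 2]
      calc ∑ k, ∫⁻ t, N t (φ k) ^ 2 ≤ ∑ k, M * ‖φ k‖ₑ ^ 2 := Finset.sum_le_sum fun k _ => hM (φ k)
        _ = M * ∑ k, ‖φ k‖ₑ ^ 2 := by rw [Finset.mul_sum]
        _ = M := by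
          have : ∑ k, ‖φ k‖ₑ ^ 2 = ENNReal.ofReal (∑ k, ‖φ k‖ ^ (2 : ℝ)) := by
            rw [ENNReal.ofReal_sum_of_nonneg fun k _ => by positivity]
            refine Finset.sum_congr rfl fun k _ => ?_
            rw [Real.rpow_ofNat, ENNReal.ofReal_pow (norm_nonneg _), ofReal_norm]
          rw [this, hφ, ENNReal.ofReal_one, mul_one]
  choose G hGm hG hGM using hatomN
  have hNw : ∀ t, N t (w t) ≤ ∑' j, ‖c j‖ₑ * N t (a j t) := fun t => by
    refine iSup_le fun n => ?_
    have h1 : HasSum (fun j => inner ℂ (d t n) (𝓕 (c j • a j t) : L2))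
        (inner ℂ (d t n) (𝓕 (w t) : L2)) :=
      ((hsum t).mapL ((Lp.fourierTransformₗᵢ R3 ℂ).toContinuousLinearEquiv :
        L2 →L[ℂ] L2)).mapL (innerSL ℂ (d t n))
    rw [← h1.tsum_eq]
    refine enorm_tsum_le_tsum_enorm.trans (ENNReal.tsum_le_tsum fun j => ?_)
    have h2 : (𝓕 (c j • a j t) : L2) = c j • (𝓕 (a j t) : L2) :=
      (Lp.fourierTransformₗᵢ R3 ℂ).map_smul _ _
    rw [h2, inner_smul_right, enorm_mul]
    gcongr
    exact le_iSup (fun n => ‖inner ℂ (d t n) (𝓕 (a j t) : L2)‖ₑ) n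
  calc ∫⁻ t, N t (w t) ^ 2 ≤ ∫⁻ t, 2 * (∑' j, ‖c j‖ₑ) * ∑' j, ‖c j‖ₑ * G j t := by
        refine lintegral_mono fun t => ?_
        refine (pow_le_pow_left₀ zero_le (hNw t) 2).trans ((tsum_mul_sq_le _ _).trans ?_)
        gcongr
        exact hG _ t
    _ = 2 * (∑' j, ‖c j‖ₑ) * ∑' j, ‖c j‖ₑ * ∫⁻ t, G j t := by
        rw [lintegral_const_mul _ (by fun_prop), lintegral_tsum fun j => by fun_prop]
        congr 1
        exact tsum_congr fun j => lintegral_const_mul _ (hGm j)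
    _ ≤ 2 * (∑' j, ‖c j‖ₑ) * ∑' j, ‖c j‖ₑ * M := by
        gcongr
        exact hGM _
    _ = _ := by rw [ENNReal.tsum_mul_right]; ring

theorem rpow_half_le_of_le {X z : ℝ≥0∞} {D : ℝ} (hD : 0 ≤ D)
    (h : X ≤ ENNReal.ofReal (D ^ 2) * z ^ 2) : X ^ (1 / 2 : ℝ) ≤ ENNReal.ofReal D * z := by
  calc X ^ (1 / 2 : ℝ) ≤ ((ENNReal.ofReal D * z) ^ 2) ^ (1 / 2 : ℝ) := by
        refine ENNReal.rpow_le_rpow ?_ (by norm_num)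
        rwa [mul_pow, ← ENNReal.ofReal_pow hD]
    _ = _ := by
        rw [← ENNReal.rpow_natCast, ← ENNReal.rpow_mul]
        norm_num

end KleinGordon


open KleinGordon in
theorem lemma3p6 (m : ℝ) (hm : 0 < m) (ε : ℝ) (hε : 0 < ε) (A : ℝ) (hA : 1 ≤ A) :
    ∃ C : ℝ, 0 < C ∧ ∀ (lam mu : ℝ) (Q : Set R3),
      1 ≤ A * mu → mu ≤ A * lam → IsCube mu Q →
      lam ≤ A * Metric.infDist 0 Q → Metric.infDist 0 Q ≤ A * lam →
        (∀ f : L2, FreqSupportedIn f Q →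
          normL2Linf (fun t => S m t f) ≤
            ENNReal.ofReal (C * (mu * lam) ^ (1 / 2 : ℝ) * lam ^ ε) * ‖f‖ₑ) ∧
        (∀ u : ℝ → L2, MemUm 2 m u → (∀ t, FreqSupportedIn (u t) Q) →
          normL2Linf u ≤
            ENNReal.ofReal (C * (mu * lam) ^ (1 / 2 : ℝ) * lam ^ ε) * normUm 2 m u) := by
  obtain ⟨C, hC0, hC⟩ := exists_lintegral_iSup_inner_waveVec_le (m := m) hm hε hA
  refine ⟨Real.sqrt (2 * C), Real.sqrt_pos.2 (by positivity), fun lam mu Q h1 h2 hQ h3 h4 => ?_⟩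
  have hA0 : 0 < A := by linarith
  have hmu : 0 < mu := pos_of_mul_pos_right (by linarith) hA0.le
  have hlam : 0 < lam := pos_of_mul_pos_right (by linarith) hA0.le
  have hN := hC lam mu Q hQ h1 h2 h3 h4
  set D : ℝ := Real.sqrt (2 * C) * (mu * lam) ^ (1 / 2 : ℝ) * lam ^ ε with hD
  have hDp : 0 < D := by positivity
  have hD2 : D ^ 2 = 2 * (C * (mu * lam * lam ^ (2 * ε))) := by
    rw [hD, mul_pow, mul_pow, Real.sq_sqrt (by positivity), ← Real.rpow_natCast _ 2,
      ← Real.rpow_mul (by positivity), ← Real.rpow_natCast (lam ^ ε) 2, ← Real.rpow_mul hlam.le]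
    norm_num
    ring_nf
  have hN' : ∀ g : L2, ∫⁻ t, (⨆ n, ‖inner ℂ (waveVec (memLp_freqIndicator hQ.isCompact)
        m t (TopologicalSpace.denseSeq R3 n))
      (𝓕 g : L2)‖ₑ) ^ 2 ≤ ENNReal.ofReal (C * (mu * lam * lam ^ (2 * ε))) * ‖g‖ₑ ^ 2 := fun g => by
    have := hN (𝓕 g)
    rwa [show ‖(𝓕 g : L2)‖ₑ = ‖g‖ₑ by rw [← ofReal_norm, ← ofReal_norm, Lp.norm_fourier_eq]]
      at this
  refine ⟨fun f hf => rpow_half_le_of_le hDp.le ?_, fun u _ hu => ?_⟩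
  · refine (lintegral_mono fun t =>
      pow_le_pow_left₀ zero_le (eLpNorm_S_le hQ.isCompact hf m t) 2).trans ((hN' f).trans ?_)
    gcongr
    rw [hD2]
    have : 0 ≤ C * (mu * lam * lam ^ (2 * ε)) := by positivity
    linarith
  · have hDtop : ENNReal.ofReal D ≠ 0 := (ENNReal.ofReal_pos.2 hDp).ne'
    rw [normUm, normU]
    simp_rw [ENNReal.mul_iInf_of_ne hDtop ENNReal.ofReal_ne_top]
    refine le_iInf fun c => le_iInf fun a => le_iInf fun hr => rpow_half_le_of_le hDp.le ?_
    have hu' : ∀ t, eLpNorm (u t) ∞ volume ≤ ⨆ n,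
        ‖inner ℂ (waveVec (memLp_freqIndicator hQ.isCompact)
        m t (TopologicalSpace.denseSeq R3 n)) (𝓕 (S m (-t) (u t)) : L2)‖ₑ := by
      intro t
      have := eLpNorm_S_le hQ.isCompact ((hu t).S m (-t)) m t
      rwa [S_S_neg] at this
    refine (lintegral_mono fun t => pow_le_pow_left₀ zero_le (hu' t) 2).trans
      ((lintegral_iSup_inner_sq_le_of_isURepr (fun g n => ?_) hN' hr).trans (le_of_eq ?_))
    · exact ((continuous_waveVec _ (hasCompactSupport_freqIndicator hQ.isCompact) m _).inner
        continuous_const).enorm.measurable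
    · rw [hD2, ENNReal.ofReal_mul zero_le_two, ENNReal.ofReal_ofNat]
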